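/- Let $K$ be a field of characteristic zero, let $I=(f_1,\dots,f_m)$ be a prime ideal of $P_n=K[x_1,\dots,x_n]$, and let $\mathcal A=S^{-1}(P_n/I)$ be a domain, where $S$ is a multiplicative subset of $P_n/I$ (a domain of essentially finite type). Let $Q$ be the field of fractions of $\mathcal A$. Suppose that $\mathcal A$ is a Poisson algebra over $K$, i.e. it carries a $K$-bilinear Lie bracket $\{\cdot,\cdot\}$ with $\{a,xy\}=\{a,x\}y+x\{a,y\}$ for all $a,x,y\in\mathcal A$. Put $\mathrm{pad}_a=\{a,\cdot\}$. For a Poisson algebra $\mathcal P$, let $P\mathcal D(\mathcal P)$ be the subalgebra of $\mathrm{End}_K(\mathcal P)$ generated by the multiplications by elements of $\mathcal P$ and by all $\mathrm{pad}_a$, $a\in\mathcal P$. Let $r$ be the rank over $Q$ of the Jacobian matrix $\left(\frac{\partial f_i}{\partial x_j}\right)$, let $d$ be the rank over $Q$ of the $n\times n$ matrix $\mathcal C_{\mathcal A}=(\{x_i,x_j\})$, and let $$\mathrm{GK}(R)=\sup_V\limsup_{k\to\infty}\frac{\log\dim_K V^k}{\log k}$$ (where $V$ runs over the finite-dimensional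 subspaces of $R$ containing $1$) be the Gelfand–Kirillov dimension of a $K$-algebra $R$. Then: 1. $\mathrm{GK}(P\mathcal D(\mathcal A))=\mathrm{GK}(\mathcal A)+d=n-r+d$. 2. Let $i_1<\cdots<i_d$ and $j_1<\cdots<j_d$ be indices in $\{1,\dots,n\}$ such that the minor $\mu=\det(\{x_{i_s},x_{j_t}\})_{s,t=1,\dots,d}$ of $\mathcal C_{\mathcal A}$ is nonzero. Then the powers of $\mu$ form a left and right Ore set in $P\mathcal D(\mathcal A)$, the Poisson bracket extends uniquely to $\mathcal A_\mu$, and the action of $P\mathcal D(\mathcal A)$ on $\mathcal A$ extends to an isomorphism of $K$-algebras $P\mathcal D(\mathcal A)_\mu\simeq P\mathcal D(\mathcal A_\mu)$. Moreover, $$P\mathcal D(\mathcal A_\mu)=\bigoplus_{\alpha\in\mathbb N^d}\mathcal A_\mu\,\mathrm{pad}_{x_{i_1}}^{\alpha_1}\cdots\mathrm{pad}_{x_{i_d}}^{\alpha_d}=\bigoplus_{\alpha\in\mathbb N^d}\mathcal A_\mu\,\mathrm{pad}_{x_{j_1}}^{\alpha_1}\cdots\mathrm{pad}_{x_{j_d}}^{\alpha_d},$$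 where in both sums the ordered monomials are a basis of the left $\mathcal A_\mu$-module $P\mathcal D(\mathcal A_\mu)$, and $\mathrm{GK}(P\mathcal D(\mathcal A)_\mu)=\mathrm{GK}(\mathcal A)+d$. -/

import Mathlib

open Filter

noncomputable section

universe u v

/-- A Poisson structure on the commutative `K`-algebra `A`: a `K`-bilinear bracket `{·,·}` which is
a Lie bracket (alternating, with the Jacobi identity) and satisfies the Leibniz rule in the second
variable (hence, by skew-symmetry, in both). -/
@[ext]
structure PoissonStructure (K : Type u) (A : Type v) [Field K] [CommRing A] [Algebra K A] where
  /-- `pad a` is the Hamiltonian derivation `{a, ·}`, so that `pad a b` is the bracket `{a, b}`. -/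
  pad : A →ₗ[K] Module.End K A
  self_eq_zero : ∀ a, pad a a = 0
  jacobi : ∀ a b c, pad a (pad b c) + pad b (pad c a) + pad c (pad a b) = 0
  leibniz : ∀ a b c, pad a (b * c) = pad a b * c + b * pad a c

namespace PoissonStructure

variable {K : Type u} {A : Type v} [Field K] [CommRing A] [Algebra K A]

/-- The algebra of Poisson differential operators: the subalgebra of `End_K(A)` generated by
the multiplications by elements of `A` and the Hamiltonian derivations `{a, ·}`, `a ∈ A`. -/
def diffOp (β : PoissonStructure K A) : Subalgebra K (Module.End K A) :=
  Algebra.adjoin K (Set.range (fun a : A => LinearMap.mulLeft K a) ∪ Set.range β.pad)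

/-- Multiplication by `a`, as an element of the algebra of Poisson differential operators. -/
def mulOp (β : PoissonStructure K A) (a : A) : β.diffOp :=
  ⟨LinearMap.mulLeft K a, Algebra.subset_adjoin (Or.inl ⟨a, rfl⟩)⟩

/-- The matrix `({x_i, x_j})`. -/
def bracketMatrix (β : PoissonStructure K A) {n : ℕ} (x : Fin n → A) : Matrix (Fin n) (Fin n) A :=
  Matrix.of fun i j => β.pad (x i) (x j)

/-- The ordered monomial `{y_1, ·}^{α_1} ∘ ⋯ ∘ {y_d, ·}^{α_d}` in Hamiltonian derivations. -/
def padMonomial (β : PoissonStructure K A) {d : ℕ} (y : Fin d → A) (α : Fin d → ℕ) :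
    Module.End K A :=
  (List.ofFn fun s => β.pad (y s) ^ α s).prod

/-- The Poisson structure `γ` on the `A`-algebra `B` extends `β`: the structure map `A → B` is a
homomorphism of Poisson algebras. -/
def Extends (β : PoissonStructure K A) {B : Type*} [CommRing B] [Algebra K B] [Algebra A B]
    (γ : PoissonStructure K B) : Prop :=
  ∀ a b : A, γ.pad (algebraMap A B a) (algebraMap A B b) = algebraMap A B (β.pad a b)

end PoissonStructure

/-- The Gelfand-Kirillov dimension of a `K`-algebra `R`: the supremum, over all finite-dimensional
subspaces `V` of `R` containing `1`, of `limsup_k log (dim V ^ k) / log k`. -/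
def gkDim (K : Type*) (R : Type*) [Field K] [Semiring R] [Algebra K R] : EReal :=
  ⨆ V : {V : Submodule K R // V.FG ∧ (1 : R) ∈ V},
    limsup (fun k : ℕ =>
      ((Real.log (Module.finrank K ↥(V.1 ^ k)) / Real.log k : ℝ) : EReal)) atTop

/-- The affine algebra `K[x_1, …, x_n] / (f_1, …, f_m)`. -/
abbrev AffineAlg {K : Type*} [Field K] {n m : ℕ} (f : Fin m → MvPolynomial (Fin n) K) : Type _ :=
  MvPolynomial (Fin n) K ⧸ Ideal.span (Set.range f)

section Presentation

variable {K : Type*} [Field K] {n m : ℕ} (f : Fin m → MvPolynomial (Fin n) K)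
  (A : Type*) [CommRing A] [Algebra (AffineAlg f) A]

/-- The canonical map `K[x_1, …, x_n] → A` for an algebra `A` over
`K[x_1, …, x_n] / (f_1, …, f_m)`. -/
def presentationMap : MvPolynomial (Fin n) K →+* A :=
  (algebraMap (AffineAlg f) A).comp (Ideal.Quotient.mk (Ideal.span (Set.range f)))

/-- The images of `x_1, …, x_n` in `A`. -/
def coordinate (i : Fin n) : A := presentationMap f A (MvPolynomial.X i)

/-- The Jacobian matrix `(∂f_i / ∂x_j)` with entries in `A`. -/
def jacobianMat : Matrix (Fin m) (Fin n) A :=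
  Matrix.of fun i j => presentationMap f A (MvPolynomial.pderiv j (f i))

end Presentation

/-- The rank of a matrix over a domain, computed over its field of fractions. -/
def fracRank {A : Type*} [CommRing A] [IsDomain A] {m n : ℕ} (M : Matrix (Fin m) (Fin n) A) : ℕ :=
  (M.map (algebraMap A (FractionRing A))).rank

end

/-! ### Words in derivations and their commutators with multiplications. -/

noncomputable section

/-! The main tool is the commutator `P ↦ [P, y]` with a multiplication (`commMul`), which is linear
over the functions. For a derivation, `[δ, y] = δ(y)` is a multiplication; hence `p` commutators
turn a word `δ_1 ⋯ δ_p` into the scalar `p! ∏ δ_s(y)`, and one more kills it. So `[·, y]` is locally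
nilpotent on Poisson differential operators.

Consequences. Applied to a relation among ordered monomials, the commutators leave a homogeneous
form vanishing at all vectors `(δ_s(y))_s`. Letting `y` run over the `K`-combinations of elements
`x_t` with `det (δ_s(x_t)) ≠ 0` forces that form to be zero, so ordered monomials are independent
(`linearIndependent_derivWord_canonWord`). Local nilpotence also yields both Ore conditions, and
shows that an operator on a localization is determined on the original algebra; this gives `PD(A)_μ
≃ PD(A_μ)`.

Spanning: a derivation is determined by its values on the coordinates, so Cramer's rule for `({x_i,
x_j})` expresses `μ pad_{x_l}` through the `d` chosen rows. Over `A_μ` these `d` derivations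
generate all Hamiltonian ones, the Jacobi identity keeps their commutators in their span, and words
can be sorted.

Growth: let `t` be the transcendence degree. Both `t` and `n - r` are the dimension of the space of
`K`-derivations of the fraction field. Monomials in `t` independent coordinates times ordered
monomials give `GK(PD(A)) ≥ t + d`. In the other direction `PD(A)` embeds in `PD(A_μ)`. Finitely
many operators there lie in a filtration by powers of a finite-dimensional space `W`, with a fixed
weight per derivation. Sorting does not raise weights, so the dimension is at most `(k+1)^d dim
W^k`, and Noether normalization bounds `dim W^k` by degree `t`. Hence both algebras have dimension
`t + d`.

The bracket extends uniquely to `A_μ` because derivations extend uniquely along formally étale maps.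
-/

/-- The composite of the derivations indexed by the letters of a word. -/
def derivWord {K B ι : Type*} [CommRing K] [CommRing B] [Algebra K B]
    (δ : ι → Derivation K B B) (l : List ι) : Module.End K B :=
  (l.map fun s => (δ s : B →ₗ[K] B)).prod

/-- The exponent vector `α` spelled out as an increasing word. -/
def canonWord {d : ℕ} (α : Fin d → ℕ) : List (Fin d) :=
  (List.ofFn fun s => List.replicate (α s) s).flatten

/-- The commutator with the multiplication by `y`, as a `B`-linear map. -/
def commMul (K : Type*) {B : Type*} [CommRing K] [CommRing B] [Algebra K B] (y : B) :
    Module.End K B →ₗ[B] Module.End K B where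
  toFun P := P * LinearMap.mulLeft K y - y • P
  map_add' P Q := by rw [add_mul, smul_add]; abel
  map_smul' b P := by
    ext z
    simp [mul_sub, mul_left_comm]

section Words

variable {K B ι : Type*} [CommRing K] [CommRing B] [Algebra K B]

theorem commMul_apply (y : B) (P : Module.End K B) :
    commMul K y P = P * LinearMap.mulLeft K y - y • P := rfl

theorem smul_eq_mulLeft_mul (b : B) (P : Module.End K B) : b • P = LinearMap.mulLeft K b * P := by
  ext z; simp

theorem derivation_mul_smul (D : Derivation K B B) (b : B) (P : Module.End K B) :
    ((D : B →ₗ[K] B) : Module.End K B) * (b • P) =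
      b • (((D : B →ₗ[K] B) : Module.End K B) * P) + D b • P := by
  ext z; simp [mul_comm]

@[simp] theorem derivWord_nil (δ : ι → Derivation K B B) : derivWord δ [] = 1 := rfl

@[simp] theorem derivWord_cons (δ : ι → Derivation K B B) (s : ι) (l : List ι) :
    derivWord δ (s :: l) = ((δ s : B →ₗ[K] B) : Module.End K B) * derivWord δ l := by
  simp [derivWord]

/-- The commutator with `y` satisfies the Leibniz rule for composition, and `[D, y]` is
multiplication by `D y`. -/
theorem commMul_derivation_mul (y : B) (D : Derivation K B B) (P : Module.End K B) :
    commMul K y (((D : B →ₗ[K] B) : Module.End K B) * P) =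
      ((D : B →ₗ[K] B) : Module.End K B) * commMul K y P + D y • P := by
  rw [commMul_apply, commMul_apply, mul_sub, derivation_mul_smul, mul_assoc]
  abel

/-- Iterated Leibniz rule: since `[D, y]` is a multiplication, `[[D, y], y] = 0` and only two
binomial terms survive. -/
theorem commMul_iterate_derivation_mul (y : B) (D : Derivation K B B) (P : Module.End K B)
    (k : ℕ) :
    (commMul K y)^[k + 1] (((D : B →ₗ[K] B) : Module.End K B) * P) =
      ((D : B →ₗ[K] B) : Module.End K B) * (commMul K y)^[k + 1] P +
        ((k + 1 : ℕ) : B) • D y • (commMul K y)^[k] P := by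
  induction k with
  | zero => simp [commMul_derivation_mul]
  | succ k ih =>
    rw [Function.iterate_succ_apply', ih, map_add, commMul_derivation_mul, map_smul, map_smul,
      ← Function.iterate_succ_apply' (commMul K y) (k + 1),
      ← Function.iterate_succ_apply' (commMul K y) k, add_assoc]
    congr 1
    rw [Nat.cast_succ (k + 1), add_smul, one_smul, add_comm]

theorem commMul_iterate_derivWord_eq_zero (δ : ι → Derivation K B B) (y : B) (l : List ι) :
    ∀ k, l.length < k → (commMul K y)^[k] (derivWord δ l) = 0 := by
  induction l with
  | nil =>
    intro k hk
    obtain ⟨k, rfl⟩ := Nat.exists_eq_succ_of_ne_zero (by simpa using hk.ne' : k ≠ 0)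
    rw [Function.iterate_succ_apply]
    have : commMul K y (derivWord δ []) = 0 := by
      ext z; simp [commMul_apply]
    rw [this]
    exact iterate_map_zero _ _
  | cons s l ih =>
    intro k hk
    rw [List.length_cons] at hk
    obtain ⟨k, rfl⟩ := Nat.exists_eq_succ_of_ne_zero (by omega : k ≠ 0)
    rw [derivWord_cons, Nat.succ_eq_add_one, commMul_iterate_derivation_mul, ih _ (by omega),
      ih _ (by omega)]
    simp

/-- This recovers the principal symbol of the word, evaluated at the differential of `y`. The order
of the letters is lost, which is harmless for ordered monomials. -/
theorem commMul_iterate_derivWord (δ : ι → Derivation K B B) (y : B) (l : List ι) :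
    (commMul K y)^[l.length] (derivWord δ l) =
      ((l.length.factorial : B) * (l.map fun s => δ s y).prod) • (1 : Module.End K B) := by
  induction l with
  | nil => simp
  | cons s l ih =>
    rw [derivWord_cons, List.length_cons, commMul_iterate_derivation_mul, ih,
      commMul_iterate_derivWord_eq_zero _ _ _ _ (Nat.lt_succ_self _), mul_zero, zero_add,
      smul_smul, smul_smul, List.map_cons, List.prod_cons, Nat.factorial_succ]
    congr 1
    push_cast
    ring

/-- Local nilpotence, the source of the Ore conditions and of the comparison with localizations. -/
theorem exists_commMul_iterate_eq_zero (δ : ι → Derivation K B B) (y : B) {P : Module.End K B}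
    (hP : P ∈ Submodule.span B (Set.range (derivWord δ))) :
    ∃ m, ∀ k, m ≤ k → (commMul K y)^[k] P = 0 := by
  induction hP using Submodule.span_induction with
  | mem P h =>
    obtain ⟨l, rfl⟩ := h
    exact ⟨l.length + 1, fun k hk => commMul_iterate_derivWord_eq_zero _ _ _ _ hk⟩
  | zero => exact ⟨0, fun k _ => iterate_map_zero _ _⟩
  | add P Q _ _ hP hQ =>
    obtain ⟨m, hm⟩ := hP
    obtain ⟨m', hm'⟩ := hQ
    refine ⟨max m m', fun k hk => ?_⟩
    rw [iterate_map_add, hm k (by omega), hm' k (by omega), add_zero]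
  | smul b P _ hP =>
    obtain ⟨m, hm⟩ := hP
    refine ⟨m, fun k hk => ?_⟩
    have : ∀ k, (commMul K y)^[k] (b • P) = b • (commMul K y)^[k] P := by
      intro k
      induction k with
      | zero => rfl
      | succ k ih => rw [Function.iterate_succ_apply', ih, map_smul, Function.iterate_succ_apply']
    rw [this, hm k hk, smul_zero]

theorem derivation_mul_mem_span_derivWord (δ : ι → Derivation K B B) (s : ι) {P : Module.End K B}
    (hP : P ∈ Submodule.span B (Set.range (derivWord δ))) :
    ((δ s : B →ₗ[K] B) : Module.End K B) * P ∈ Submodule.span B (Set.range (derivWord δ)) := by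
  induction hP using Submodule.span_induction with
  | mem P h =>
    obtain ⟨l, rfl⟩ := h
    rw [← derivWord_cons]
    exact Submodule.subset_span ⟨_, rfl⟩
  | zero => rw [mul_zero]; exact zero_mem _
  | add P Q _ _ hP hQ => rw [mul_add]; exact add_mem hP hQ
  | smul b P h hP =>
    rw [derivation_mul_smul]
    exact add_mem (Submodule.smul_mem _ _ hP) (Submodule.smul_mem _ _ h)

theorem mul_mem_span_derivWord (δ : ι → Derivation K B B) {P Q : Module.End K B}
    (hP : P ∈ Submodule.span B (Set.range (derivWord δ)))
    (hQ : Q ∈ Submodule.span B (Set.range (derivWord δ))) :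
    P * Q ∈ Submodule.span B (Set.range (derivWord δ)) := by
  induction hP using Submodule.span_induction with
  | mem P h =>
    obtain ⟨l, rfl⟩ := h
    induction l with
    | nil => simpa using hQ
    | cons s l ih =>
      rw [derivWord_cons, mul_assoc]
      exact derivation_mul_mem_span_derivWord δ s ih
  | zero => rw [zero_mul]; exact zero_mem _
  | add P Q _ _ hP hQ => rw [add_mul]; exact add_mem hP hQ
  | smul b P h hP =>
    rw [smul_mul_assoc]
    exact Submodule.smul_mem _ _ hP

theorem smul_one_mem_span_derivWord (δ : ι → Derivation K B B) (b : B) :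
    b • (1 : Module.End K B) ∈ Submodule.span B (Set.range (derivWord δ)) :=
  Submodule.smul_mem _ _ (Submodule.subset_span ⟨[], rfl⟩)

theorem mulLeft_mem_span_derivWord (δ : ι → Derivation K B B) (b : B) :
    LinearMap.mulLeft K b ∈ Submodule.span B (Set.range (derivWord δ)) := by
  rw [← mul_one (LinearMap.mulLeft K b), ← smul_eq_mulLeft_mul]
  exact smul_one_mem_span_derivWord δ b

theorem derivation_mem_span_derivWord (δ : ι → Derivation K B B) (s : ι) :
    ((δ s : B →ₗ[K] B) : Module.End K B) ∈ Submodule.span B (Set.range (derivWord δ)) :=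
  Submodule.subset_span ⟨[s], by simp⟩

theorem length_canonWord {d : ℕ} (α : Fin d → ℕ) : (canonWord α).length = ∑ s, α s := by
  simp [canonWord, List.length_flatten, List.sum_ofFn, List.map_ofFn, Function.comp_def]

theorem derivWord_canonWord {d : ℕ} (δ : Fin d → Derivation K B B) (α : Fin d → ℕ) :
    derivWord δ (canonWord α) =
      (List.ofFn fun s => ((δ s : B →ₗ[K] B) : Module.End K B) ^ α s).prod := by
  simp [canonWord, derivWord, List.map_flatten, List.prod_flatten, List.map_ofFn,
    Function.comp_def, List.prod_replicate]

theorem prod_map_canonWord {d : ℕ} (g : Fin d → B) (α : Fin d → ℕ) :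
    ((canonWord α).map g).prod = ∏ s, g s ^ α s := by
  simp [canonWord, List.map_flatten, List.prod_flatten, List.map_ofFn,
    Function.comp_def, List.prod_replicate, List.prod_ofFn]

theorem count_canonWord {d : ℕ} (α : Fin d → ℕ) (s : Fin d) : (canonWord α).count s = α s := by
  simp [canonWord, List.count_flatten, List.map_ofFn, Function.comp_def, List.sum_ofFn,
    List.count_replicate]

theorem perm_canonWord {d : ℕ} (l : List (Fin d)) : l.Perm (canonWord fun s => l.count s) := by
  rw [List.perm_iff_count]
  intro s
  rw [count_canonWord]

end Words

/-! ### Linear independence of ordered monomials. -/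

/-- Ordered monomials in derivations with nondegenerate values on some elements are linearly
independent. -/
theorem linearIndependent_derivWord_canonWord {K B : Type*} [Field K] [CharZero K] [CommRing B]
    [IsDomain B] [Algebra K B] {d : ℕ} (δ : Fin d → Derivation K B B) (x : Fin d → B)
    (hM : (Matrix.of fun s t => δ s (x t)).det ≠ 0) :
    LinearIndependent B fun α : Fin d → ℕ => derivWord δ (canonWord α) := by
  classical
  have : CharZero B := charZero_of_injective_algebraMap (algebraMap K B).injective
  set M : Matrix (Fin d) (Fin d) B := Matrix.of fun s t => δ s (x t) with hMdef
  rw [linearIndependent_iff]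
  intro c hc
  by_contra hne
  obtain ⟨α₀, hα₀, hmax⟩ := c.support.exists_max_image (fun α => ∑ s, α s)
    (Finsupp.support_nonempty_iff.2 hne)
  set p := ∑ s, α₀ s with hp
  set T := c.support.filter (fun α => ∑ s, α s = p) with hT
  -- With `p` the maximal total degree, `p` commutators kill the lower terms and make the top ones
  -- scalars; the factor `p!` cancels in characteristic zero.
  have key : ∀ y : B, ∑ α ∈ T, c α * ∏ s, (δ s y) ^ α s = 0 := by
    intro y
    have h1 := congrArg (commMul K y)^[p] hc
    rw [iterate_map_zero, ← Module.End.coe_pow, Finsupp.linearCombination_apply, Finsupp.sum,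
      map_sum] at h1
    have h2 : ∑ α ∈ T, (((p.factorial : B) * (c α * ∏ s, (δ s y) ^ α s)) •
        (1 : Module.End K B)) = 0 := by
      rw [← h1, hT, Finset.sum_filter]
      refine Finset.sum_congr rfl fun α hα => ?_
      rw [map_smul, Module.End.coe_pow]
      split_ifs with h
      · rw [← h, ← length_canonWord, commMul_iterate_derivWord, prod_map_canonWord, smul_smul,
          mul_left_comm]
      · rw [commMul_iterate_derivWord_eq_zero, smul_zero]
        rw [length_canonWord]
        exact lt_of_le_of_ne (hmax α hα) h
    rw [← Finset.sum_smul, ← Finset.mul_sum] at h2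
    have h3 := LinearMap.congr_fun h2 1
    simp only [LinearMap.smul_apply, Module.End.one_apply, smul_eq_mul, mul_one,
      LinearMap.zero_apply] at h3
    exact (mul_eq_zero.1 h3).resolve_left (by exact_mod_cast p.factorial_ne_zero)
  set σ : MvPolynomial (Fin d) B :=
    ∑ α ∈ T, MvPolynomial.monomial (Finsupp.equivFunOnFinite.symm α) (c α) with hσ
  have evalσ : ∀ v : Fin d → B, MvPolynomial.eval v σ = ∑ α ∈ T, c α * ∏ s, v s ^ α s := by
    intro v
    simp [hσ, MvPolynomial.eval_monomial, Finsupp.prod_fintype]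
  set τ : MvPolynomial (Fin d) B := MvPolynomial.bind₁
    (fun s => ∑ t, MvPolynomial.C (M s t) * MvPolynomial.X t) σ with hτ
  have evalτ : ∀ v : Fin d → B, MvPolynomial.eval v τ = MvPolynomial.eval (M.mulVec v) σ := by
    intro v
    rw [hτ, ← MvPolynomial.coe_aeval_eq_eval, RingHom.coe_coe, MvPolynomial.aeval_bind₁,
      ← MvPolynomial.coe_aeval_eq_eval, RingHom.coe_coe]
    congr 2
    ext s
    simp [Matrix.mulVec, dotProduct]
  have hτ0 : τ = 0 := by
    refine MvPolynomial.funext_set (fun _ => Set.range (algebraMap K B))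
      (fun _ => Set.infinite_range_of_injective (algebraMap K B).injective) ?_
    intro v hv
    rw [evalτ, map_zero, evalσ]
    have hv' : ∀ t, ∃ a : K, algebraMap K B a = v t := fun t => hv t (Set.mem_univ t)
    choose a ha using hv'
    -- For `y = ∑ a_t x_t` with constant `a_t`, the vector `(δ_s y)_s` is `M a`. Vanishing on the
    -- infinite field `K` suffices for `τ = 0`.
    have := key (∑ t, a t • x t)
    convert this using 5 with α hα s
    simp [Matrix.mulVec, dotProduct, hMdef, ← ha, Algebra.smul_def, mul_comm]
  have hσ0 : σ = 0 := by
    have : Infinite B := CharZero.infinite B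
    refine MvPolynomial.funext fun v => ?_
    -- Since `M (adj M) v = det M • v` and `σ` is homogeneous of degree `p`, this gives `(det M)^p
    -- σ(v) = 0` without inverting `M`.
    have h1 := evalτ (M.adjugate.mulVec v)
    rw [hτ0, map_zero, Matrix.mulVec_mulVec, Matrix.mul_adjugate, Matrix.smul_mulVec,
      Matrix.one_mulVec, evalσ] at h1
    have h2 : ∑ α ∈ T, c α * ∏ s, (M.det • v) s ^ α s =
        M.det ^ p * ∑ α ∈ T, c α * ∏ s, v s ^ α s := by
      rw [Finset.mul_sum]
      refine Finset.sum_congr rfl fun α hα => ?_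
      simp only [Pi.smul_apply, smul_eq_mul, mul_pow, Finset.prod_mul_distrib,
        Finset.prod_pow_eq_pow_sum]
      rw [(Finset.mem_filter.1 hα).2]
      ring
    rw [h2] at h1
    rw [map_zero, evalσ]
    exact (mul_eq_zero.1 h1.symm).resolve_left (pow_ne_zero _ hM)
  have h1 := congrArg (MvPolynomial.coeff (Finsupp.equivFunOnFinite.symm α₀)) hσ0
  rw [hσ, MvPolynomial.coeff_sum, MvPolynomial.coeff_zero] at h1
  simp only [MvPolynomial.coeff_monomial, EmbeddingLike.apply_eq_iff_eq] at h1
  simp only [Finset.sum_ite_eq'] at h1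
  rw [if_pos (by rw [hT]; exact Finset.mem_filter.2 ⟨hα₀, hp.symm⟩)] at h1
  exact Finsupp.mem_support_iff.1 hα₀ h1

/-! ### Hamiltonian derivations and the algebra they generate. -/

namespace PoissonStructure

variable {K : Type u} {A : Type v} [Field K] [CommRing A] [Algebra K A]

/-- The Hamiltonian derivation `{a, ·}`. -/
def ham (β : PoissonStructure K A) (a : A) : Derivation K A A :=
  Derivation.mk' (β.pad a) fun b c => by
    rw [β.leibniz, smul_eq_mul, smul_eq_mul]; ring

theorem ham_apply (β : PoissonStructure K A) (a b : A) : β.ham a b = β.pad a b := rfl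

theorem pad_skew (β : PoissonStructure K A) (a b : A) : β.pad a b = -β.pad b a := by
  have h := β.self_eq_zero (a + b)
  simp only [map_add, LinearMap.add_apply, β.self_eq_zero, zero_add, add_zero] at h
  exact eq_neg_of_add_eq_zero_right h

theorem pad_mul (β : PoissonStructure K A) (a b : A) :
    β.pad (a * b) = a • β.pad b + b • β.pad a := by
  ext c
  rw [β.pad_skew, β.leibniz, β.pad_skew c a, β.pad_skew c b]
  simp only [LinearMap.add_apply, LinearMap.smul_apply, smul_eq_mul]
  ring

theorem pad_pad (β : PoissonStructure K A) (a b : A) :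
    β.pad a * β.pad b - β.pad b * β.pad a = β.pad (β.pad a b) := by
  ext c
  have h := β.jacobi a b c
  rw [β.pad_skew c (β.pad a b), β.pad_skew c a, map_neg] at h
  simp only [LinearMap.sub_apply, Module.End.mul_apply]
  linear_combination h

theorem mulLeft_mem_diffOp (β : PoissonStructure K A) (a : A) :
    LinearMap.mulLeft K a ∈ β.diffOp := Algebra.subset_adjoin (Or.inl ⟨a, rfl⟩)

theorem pad_mem_diffOp (β : PoissonStructure K A) (a : A) : β.pad a ∈ β.diffOp :=
  Algebra.subset_adjoin (Or.inr ⟨a, rfl⟩)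

theorem smul_mem_diffOp (β : PoissonStructure K A) (a : A) {P : Module.End K A}
    (hP : P ∈ β.diffOp) : a • P ∈ β.diffOp := by
  rw [smul_eq_mulLeft_mul]
  exact mul_mem (β.mulLeft_mem_diffOp a) hP

theorem derivWord_mem_diffOp (β : PoissonStructure K A) {ι : Type*} (y : ι → A) (l : List ι) :
    derivWord (fun s => β.ham (y s)) l ∈ β.diffOp := by
  induction l with
  | nil => exact one_mem _
  | cons s l ih => rw [derivWord_cons]; exact mul_mem (β.pad_mem_diffOp _) ih

/-- If the Hamiltonian derivations are combinations of words in `δ`, so are all operators. -/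
theorem diffOp_le_span_derivWord (β : PoissonStructure K A) {ι : Type*}
    (δ : ι → Derivation K A A)
    (h : ∀ a, β.pad a ∈ Submodule.span A (Set.range (derivWord δ))) {P : Module.End K A}
    (hP : P ∈ β.diffOp) : P ∈ Submodule.span A (Set.range (derivWord δ)) := by
  induction hP using Algebra.adjoin_induction with
  | mem P hP =>
    rcases hP with ⟨a, rfl⟩ | ⟨a, rfl⟩
    · exact mulLeft_mem_span_derivWord δ a
    · exact h a
  | algebraMap c =>
    have : algebraMap K (Module.End K A) c = LinearMap.mulLeft K (algebraMap K A c) := by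
      ext z; simp [Algebra.smul_def]
    rw [this]
    exact mulLeft_mem_span_derivWord δ _
  | add P Q _ _ hP hQ => exact add_mem hP hQ
  | mul P Q _ _ hP hQ => exact mul_mem_span_derivWord δ hP hQ

theorem mem_span_derivWord_ham (β : PoissonStructure K A) {P : Module.End K A}
    (hP : P ∈ β.diffOp) : P ∈ Submodule.span A (Set.range (derivWord β.ham)) :=
  β.diffOp_le_span_derivWord _ (fun a => derivation_mem_span_derivWord β.ham a) hP

theorem padMonomial_eq (β : PoissonStructure K A) {d : ℕ} (y : Fin d → A) (α : Fin d → ℕ) :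
    β.padMonomial y α = derivWord (fun s => β.ham (y s)) (canonWord α) := by
  rw [derivWord_canonWord]; rfl

theorem linearIndependent_padMonomial [CharZero K] [IsDomain A] (β : PoissonStructure K A) {d : ℕ}
    (y x : Fin d → A) (hM : (Matrix.of fun s t => β.pad (y s) (x t)).det ≠ 0) :
    LinearIndependent A (β.padMonomial y) := by
  have := linearIndependent_derivWord_canonWord (fun s => β.ham (y s)) x hM
  convert this using 2 with α
  exact β.padMonomial_eq y α

end PoissonStructure

/-! ### Weight filtrations and the sorting of words. -/

/-- A filtration `w` of `B`, adapted to derivations `δ s` of weight `N` whose commutators are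
combinations of the `δ s` with coefficients of weight `N`. -/
structure IsAdaptedFiltration {K B : Type*} [Field K] [CommRing B] [Algebra K B] {d : ℕ}
    (δ : Fin d → Derivation K B B) (w : ℕ → Submodule K B) (N : ℕ) : Prop where
  mono : Monotone w
  one_mem : (1 : B) ∈ w 0
  mul_mem : ∀ {i j a b}, a ∈ w i → b ∈ w j → a * b ∈ w (i + j)
  deriv_mem : ∀ s {i a}, a ∈ w i → δ s a ∈ w (i + N)
  comm : ∀ s t, ∃ c : Fin d → B, (∀ v, c v ∈ w N) ∧
    ((δ s : B →ₗ[K] B) : Module.End K B) * (δ t : B →ₗ[K] B) -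
      ((δ t : B →ₗ[K] B) : Module.End K B) * (δ s : B →ₗ[K] B) =
      ∑ v, c v • ((δ v : B →ₗ[K] B) : Module.End K B)

section Filtration

variable {K B : Type*} [Field K] [CommRing B] [Algebra K B] {d : ℕ}
  (δ : Fin d → Derivation K B B) (w : ℕ → Submodule K B) (N : ℕ)

/-- Operators of weight at most `k` and of length at most `p`. -/
def wordFiltration (k p : ℕ) : Submodule K (Module.End K B) :=
  Submodule.span K {P | ∃ j b l, b ∈ w j ∧ j + N * l.length ≤ k ∧ l.length ≤ p ∧
    b • derivWord δ l = P}

/-- Operators that are combinations of ordered monomials of weight at most `k`. -/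
def orderedFiltration (k : ℕ) : Submodule K (Module.End K B) :=
  Submodule.span K {P | ∃ j b α, b ∈ w j ∧ j + N * ∑ s, α s ≤ k ∧
    b • derivWord δ (canonWord α) = P}

variable {δ w N}

theorem wordFiltration_mono {k k' p p' : ℕ} (hk : k ≤ k') (hp : p ≤ p') :
    wordFiltration δ w N k p ≤ wordFiltration δ w N k' p' := by
  refine Submodule.span_mono ?_
  rintro P ⟨j, b, l, hb, h1, h2, rfl⟩
  exact ⟨j, b, l, hb, h1.trans hk, h2.trans hp, rfl⟩

theorem smul_derivWord_mem_wordFiltration {k p j : ℕ} {b : B} {l : List (Fin d)} (hb : b ∈ w j)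
    (h : j + N * l.length ≤ k) (hp : l.length ≤ p) :
    b • derivWord δ l ∈ wordFiltration δ w N k p :=
  Submodule.subset_span ⟨j, b, l, hb, h, hp, rfl⟩

theorem smul_derivWord_canonWord_mem_orderedFiltration {k j : ℕ} {b : B} {α : Fin d → ℕ}
    (hb : b ∈ w j) (h : j + N * ∑ s, α s ≤ k) :
    b • derivWord δ (canonWord α) ∈ orderedFiltration δ w N k :=
  Submodule.subset_span ⟨j, b, α, hb, h, rfl⟩

namespace IsAdaptedFiltration

variable (H : IsAdaptedFiltration δ w N)
include H

theorem smul_mem {k p j : ℕ} {b : B} {P : Module.End K B} (hb : b ∈ w j)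
    (hP : P ∈ wordFiltration δ w N k p) : b • P ∈ wordFiltration δ w N (j + k) p := by
  induction hP using Submodule.span_induction with
  | mem P h =>
    obtain ⟨i, c, l, hc, h1, h2, rfl⟩ := h
    rw [smul_smul]
    exact smul_derivWord_mem_wordFiltration (H.mul_mem hb hc) (by omega) h2
  | zero => rw [smul_zero]; exact zero_mem _
  | add P Q _ _ hP hQ => rw [smul_add]; exact add_mem hP hQ
  | smul c P _ hP => rw [smul_comm]; exact Submodule.smul_mem _ _ hP

theorem derivation_mul_mem {k p : ℕ} (s : Fin d) {P : Module.End K B}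
    (hP : P ∈ wordFiltration δ w N k p) :
    ((δ s : B →ₗ[K] B) : Module.End K B) * P ∈ wordFiltration δ w N (k + N) (p + 1) := by
  induction hP using Submodule.span_induction with
  | mem P h =>
    obtain ⟨i, c, l, hc, h1, h2, rfl⟩ := h
    rw [derivation_mul_smul, ← derivWord_cons]
    refine add_mem (smul_derivWord_mem_wordFiltration hc ?_ (by simpa using h2))
      (smul_derivWord_mem_wordFiltration (H.deriv_mem s hc) (by omega) (by omega))
    rw [List.length_cons, mul_add]
    omega
  | zero => rw [mul_zero]; exact zero_mem _
  | add P Q _ _ hP hQ => rw [mul_add]; exact add_mem hP hQ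
  | smul c P _ hP => rw [mul_smul_comm]; exact Submodule.smul_mem _ _ hP

theorem derivWord_mul_mem {k p : ℕ} (l : List (Fin d)) {P : Module.End K B}
    (hP : P ∈ wordFiltration δ w N k p) :
    derivWord δ l * P ∈ wordFiltration δ w N (k + N * l.length) (p + l.length) := by
  induction l with
  | nil => simpa using hP
  | cons s l ih =>
    rw [derivWord_cons, mul_assoc]
    have := H.derivation_mul_mem s ih
    rwa [List.length_cons, mul_add, mul_one, ← add_assoc, ← add_assoc]

theorem mul_mem_wordFiltration {k p k' p' : ℕ} {P Q : Module.End K B}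
    (hP : P ∈ wordFiltration δ w N k p) (hQ : Q ∈ wordFiltration δ w N k' p') :
    P * Q ∈ wordFiltration δ w N (k + k') (p + p') := by
  induction hP using Submodule.span_induction with
  | mem P h =>
    obtain ⟨i, c, l, hc, h1, h2, rfl⟩ := h
    rw [smul_mul_assoc]
    exact wordFiltration_mono (by omega) (by omega) (H.smul_mem hc (H.derivWord_mul_mem l hQ))
  | zero => rw [zero_mul]; exact zero_mem _
  | add P Q _ _ hP hQ => rw [add_mul]; exact add_mem hP hQ
  | smul c P _ hP => rw [smul_mul_assoc]; exact Submodule.smul_mem _ _ hP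

/-- A transposition of neighbours costs a commutator, which replaces two letters by one with a
coefficient in `w N`. The weight is preserved because a letter weighs `N`, and the length drops by
one. -/
theorem derivWord_sub_mem_of_perm {l l' : List (Fin d)} (h : l.Perm l') :
    derivWord δ l - derivWord δ l' ∈ wordFiltration δ w N (N * l.length) (l.length - 1) := by
  induction h with
  | nil => rw [sub_self]; exact zero_mem _
  | @cons s l l' h ih =>
    rw [derivWord_cons, derivWord_cons, ← mul_sub]
    -- For the empty tail the truncated bound `l.length - 1` is off by one, but there the difference
    -- is zero.
    rcases eq_or_ne l [] with rfl | hl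
    · rw [h.nil_eq, sub_self, mul_zero]; exact zero_mem _
    · have hl := List.length_pos_iff.2 hl
      refine wordFiltration_mono (le_of_eq ?_) ?_ (H.derivation_mul_mem s ih)
      · rw [List.length_cons, mul_add, mul_one]
      · rw [List.length_cons]; omega
  | swap s t l =>
    obtain ⟨c, hc, h⟩ := H.comm t s
    simp only [derivWord_cons]
    rw [← mul_assoc, ← mul_assoc, ← sub_mul, h, Finset.sum_mul]
    refine Submodule.sum_mem _ fun v _ => ?_
    rw [smul_mul_assoc, ← derivWord_cons]
    refine smul_derivWord_mem_wordFiltration (hc v) (le_of_eq ?_) (by simp)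
    simp only [List.length_cons]
    ring
  | trans h₁ h₂ ih₁ ih₂ =>
    rw [← sub_add_sub_cancel]
    rw [← h₁.length_eq] at ih₂
    exact add_mem ih₁ ih₂

/-- Induction on the length: a word differs from its sorted form by shorter words of no greater
weight. -/
theorem wordFiltration_le_orderedFiltration (k p : ℕ) :
    wordFiltration δ w N k p ≤ orderedFiltration δ w N k := by
  induction p using Nat.strong_induction_on generalizing k with
  | _ p ih =>
  refine Submodule.span_le.2 ?_
  rintro P ⟨j, b, l, hb, h1, h2, rfl⟩
  have hlen : l.length = ∑ s, l.count s := by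
    rw [← length_canonWord]; exact (perm_canonWord l).length_eq
  have hmain : b • derivWord δ (canonWord fun s => l.count s) ∈ orderedFiltration δ w N k :=
    smul_derivWord_canonWord_mem_orderedFiltration hb (by rw [← hlen]; exact h1)
  rcases Nat.eq_zero_or_pos l.length with h0 | hpos
  · have : l = canonWord fun s => l.count s := by
      have h3 := perm_canonWord l
      rw [List.length_eq_zero_iff.1 h0] at h3 ⊢
      exact h3.nil_eq
    rwa [this]
  · have h3 := H.smul_mem hb (H.derivWord_sub_mem_of_perm (perm_canonWord l))
    have h4 := ih (l.length - 1) (by omega) k (wordFiltration_mono h1 le_rfl h3)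
    rw [smul_sub] at h4
    have := add_mem h4 hmain
    rwa [sub_add_cancel] at this

theorem one_mem_wordFiltration : 1 ∈ wordFiltration δ w N 0 0 := by
  have := smul_derivWord_mem_wordFiltration (δ := δ) (N := N) (k := 0) (p := 0) (l := [])
    H.one_mem (by simp) (by simp)
  rwa [one_smul] at this

theorem pow_le_wordFiltration {V : Submodule K (Module.End K B)} {k p : ℕ}
    (hV : V ≤ wordFiltration δ w N k p) (q : ℕ) : V ^ q ≤ wordFiltration δ w N (q * k) (q * p) := by
  induction q with
  | zero =>
    rw [pow_zero, zero_mul, zero_mul, Submodule.one_le]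
    exact H.one_mem_wordFiltration
  | succ q ih =>
    rw [pow_succ, Submodule.mul_le, Nat.succ_mul, Nat.succ_mul]
    exact fun P hP Q hQ => H.mul_mem_wordFiltration (ih hP) (hV hQ)

/-- As letters have positive weight, weight at most `k` bounds every exponent by `k`; so `(k+1)^d`
copies of `w k` cover the filtration. -/
theorem exists_linearMap_orderedFiltration_le (hN : 0 < N) (k : ℕ) :
    ∃ Φ : ((Fin d → Fin (k + 1)) → w k) →ₗ[K] Module.End K B,
      orderedFiltration δ w N k ≤ LinearMap.range Φ := by
  classical
  let Ψ : (Fin d → Fin (k + 1)) → w k →ₗ[K] Module.End K B := fun α =>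
    ((LinearMap.toSpanSingleton B (Module.End K B)
      (derivWord δ (canonWord fun s => (α s : ℕ)))).restrictScalars K) ∘ₗ (w k).subtype
  refine ⟨LinearMap.lsum K (fun _ => w k) K Ψ, Submodule.span_le.2 ?_⟩
  rintro _ ⟨j, b, α, hb, h, rfl⟩
  have hα : ∀ s, α s < k + 1 := by
    intro s
    have h1 : α s ≤ ∑ s, α s := Finset.single_le_sum (fun _ _ => Nat.zero_le _) (Finset.mem_univ s)
    have h2 : ∑ s, α s ≤ N * ∑ s, α s := Nat.le_mul_of_pos_left _ hN
    omega
  refine ⟨Pi.single (fun s => ⟨α s, hα s⟩) ⟨b, H.mono (by omega) hb⟩, ?_⟩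
  rw [LinearMap.lsum_piSingle]
  rfl

theorem finrank_le_of_le_wordFiltration (hN : 0 < N) (k p : ℕ) [Module.Finite K (w k)]
    {V : Submodule K (Module.End K B)} (hV : V ≤ wordFiltration δ w N k p) :
    Module.finrank K V ≤ (k + 1) ^ d * Module.finrank K (w k) := by
  obtain ⟨Φ, hΦ⟩ := H.exists_linearMap_orderedFiltration_le hN k
  refine (Submodule.finrank_mono
    ((hV.trans (H.wordFiltration_le_orderedFiltration k p)).trans hΦ)).trans ?_
  refine (LinearMap.finrank_range_le Φ).trans (le_of_eq ?_)
  rw [Module.finrank_pi_fintype]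
  simp

end IsAdaptedFiltration

/-- Spanning by ordered monomials. -/
theorem span_derivWord_le_span_canonWord
    (hcomm : ∀ s t, ∃ c : Fin d → B,
      ((δ s : B →ₗ[K] B) : Module.End K B) * (δ t : B →ₗ[K] B) -
        ((δ t : B →ₗ[K] B) : Module.End K B) * (δ s : B →ₗ[K] B) =
        ∑ v, c v • ((δ v : B →ₗ[K] B) : Module.End K B)) :
    Submodule.span B (Set.range (derivWord δ)) ≤
      Submodule.span B (Set.range fun α : Fin d → ℕ => derivWord δ (canonWord α)) := by
  -- With the constant filtration `⊤` and weight `0`, the sorting lemma becomes a pure spanning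
  -- statement.
  have H : IsAdaptedFiltration δ (fun _ => (⊤ : Submodule K B)) 0 := by
    refine ⟨fun _ _ _ => le_rfl, trivial, fun _ _ => trivial, fun _ _ _ _ => trivial,
      fun s t => ?_⟩
    obtain ⟨c, hc⟩ := hcomm s t
    exact ⟨c, fun _ => trivial, hc⟩
  refine Submodule.span_le.2 ?_
  rintro _ ⟨l, rfl⟩
  have h1 : (1 : B) • derivWord δ l ∈
      wordFiltration δ (fun _ => (⊤ : Submodule K B)) 0 0 l.length :=
    smul_derivWord_mem_wordFiltration (j := 0) trivial (by simp) le_rfl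
  rw [one_smul] at h1
  have h2 := H.wordFiltration_le_orderedFiltration _ _ h1
  have h3 : orderedFiltration δ (fun _ => (⊤ : Submodule K B)) 0 0 ≤
      (Submodule.span B (Set.range fun α : Fin d → ℕ =>
        derivWord δ (canonWord α))).restrictScalars K := by
    refine Submodule.span_le.2 ?_
    rintro _ ⟨j, b, α, -, -, rfl⟩
    have h4 : derivWord δ (canonWord α) ∈ Submodule.span B (Set.range fun α : Fin d → ℕ =>
        derivWord δ (canonWord α)) := Submodule.subset_span ⟨α, rfl⟩
    exact Submodule.smul_mem _ b h4
  exact h3 h2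

end Filtration

/-! ### Estimates of Gelfand-Kirillov dimension. -/

section GK

variable {K : Type*} [Field K]

theorem tendsto_log_const_mul_pow_div_log {c : ℝ} (hc : 0 < c) (a : ℕ) (p : ℕ) :
    Tendsto (fun k : ℕ => Real.log (c * ((k : ℝ) + a) ^ p) / Real.log k) atTop (nhds (p : ℝ)) := by
  have hlog : Tendsto (fun k : ℕ => Real.log (k : ℝ)) atTop atTop :=
    Real.tendsto_log_atTop.comp tendsto_natCast_atTop_atTop
  have h1 : Tendsto (fun k : ℕ => Real.log c / Real.log (k : ℝ)) atTop (nhds 0) :=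
    hlog.const_div_atTop _
  have h2 : Tendsto (fun k : ℕ => Real.log (1 + (a : ℝ) / k) / Real.log (k : ℝ)) atTop (nhds 0) := by
    have h3 : Tendsto (fun k : ℕ => Real.log (1 + (a : ℝ) / k)) atTop (nhds (Real.log (1 + 0))) := by
      refine Tendsto.log ?_ (by norm_num)
      exact tendsto_const_nhds.add (tendsto_const_div_atTop_nhds_zero_nat _)
    exact h3.div_atTop hlog
  have h4 := (h1.add ((h2.add_const 1).const_mul (p : ℝ)))
  simp only [zero_add, mul_one] at h4
  refine h4.congr' ?_
  filter_upwards [eventually_gt_atTop 1] with k hk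
  have hk0 : (0 : ℝ) < k := by positivity
  have hlk : Real.log (k : ℝ) ≠ 0 := (Real.log_pos (by exact_mod_cast hk)).ne'
  have h5 : (k : ℝ) + a = k * (1 + a / k) := by field_simp
  rw [h5, Real.log_mul hc.ne' (by positivity), Real.log_pow, Real.log_mul hk0.ne' (by positivity)]
  field_simp
  ring

theorem gkDim_le_of_finrank_pow_le {R : Type*} [Ring R] [Algebra K R] (p : ℕ)
    (h : ∀ V : Submodule K R, V.FG → 1 ∈ V →
      ∃ c : ℕ, ∃ a : ℕ, ∀ k, Module.finrank K ↥(V ^ k) ≤ c * (k + a) ^ p) :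
    gkDim K R ≤ (p : EReal) := by
  refine iSup_le ?_
  rintro ⟨V, hV, h1⟩
  obtain ⟨c, a, hca⟩ := h V hV h1
  -- The constant `c` may be zero; `c + 1` keeps the logarithm under control.
  have ht := tendsto_log_const_mul_pow_div_log (c := (c : ℝ) + 1) (by positivity) a p
  have ht' := (continuous_coe_real_ereal.tendsto _).comp ht
  refine le_of_le_of_eq (limsup_le_limsup ?_) ht'.limsup_eq
  filter_upwards [eventually_gt_atTop 1] with k hk
  simp only [Function.comp_apply, EReal.coe_le_coe_iff]
  have hlk : 0 < Real.log (k : ℝ) := Real.log_pos (by exact_mod_cast hk)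
  refine div_le_div_of_nonneg_right ?_ hlk.le
  rcases Nat.eq_zero_or_pos (Module.finrank K ↥(V ^ k)) with h0 | h0
  · rw [h0, Nat.cast_zero, Real.log_zero]
    apply Real.log_nonneg
    have h2 : (1 : ℝ) ≤ ((k : ℝ) + a) ^ p := by
      apply one_le_pow₀
      have : (1 : ℝ) ≤ k := by exact_mod_cast hk.le
      have : (0 : ℝ) ≤ a := by positivity
      linarith
    nlinarith [(Nat.cast_nonneg c : (0 : ℝ) ≤ c)]
  · apply Real.log_le_log (by exact_mod_cast h0)
    have h2 : ((Module.finrank K ↥(V ^ k) : ℕ) : ℝ) ≤ c * ((k : ℝ) + a) ^ p := by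
      exact_mod_cast hca k
    have h3 : (0 : ℝ) ≤ ((k : ℝ) + a) ^ p := by positivity
    linarith

/-- Since `1 ∈ V` the powers increase, so multiples of `m` suffice: the factor `(1/m)^p` disappears
after division by `log k`. -/
theorem le_gkDim_of_le_finrank_pow {R : Type*} [Ring R] [Algebra K R] (p : ℕ)
    {V : Submodule K R} (hV : V.FG) (h1 : 1 ∈ V) {m : ℕ} (hm : 0 < m)
    (h : ∀ k, (k + 1) ^ p ≤ Module.finrank K ↥(V ^ (m * k))) :
    (p : EReal) ≤ gkDim K R := by
  refine le_trans ?_ (le_iSup _ (⟨V, hV, h1⟩ : {V : Submodule K R // V.FG ∧ (1 : R) ∈ V}))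
  have hm' : (0 : ℝ) < m := by exact_mod_cast hm
  have ht := tendsto_log_const_mul_pow_div_log (c := (1 / m : ℝ) ^ p) (by positivity) 0 p
  have ht' := (continuous_coe_real_ereal.tendsto _).comp ht
  refine le_of_eq_of_le ht'.limsup_eq.symm (limsup_le_limsup ?_)
  filter_upwards [eventually_gt_atTop 1] with k hk
  simp only [Function.comp_apply, EReal.coe_le_coe_iff]
  have hlk : 0 < Real.log (k : ℝ) := Real.log_pos (by exact_mod_cast hk)
  have hk0 : (0 : ℝ) < k := by positivity
  gcongr
  rw [← mul_pow, Nat.cast_zero, add_zero]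
  have h2 : (1 / m * k : ℝ) ≤ ((k / m + 1 : ℕ) : ℝ) := by
    have := Nat.lt_div_mul_add hm (a := k)
    rw [one_div_mul_eq_div, div_le_iff₀ hm']
    have h3 : k ≤ (k / m + 1) * m := by rw [add_mul, one_mul]; omega
    exact_mod_cast h3
  have h3 : V ^ (m * (k / m)) ≤ V ^ k :=
    pow_le_pow_right₀ (Submodule.one_le.2 h1) (Nat.mul_div_le k m)
  have : Module.Finite K ↥(V ^ k) := Module.Finite.iff_fg.2 (hV.pow k)
  calc (1 / m * k : ℝ) ^ p ≤ ((k / m + 1 : ℕ) : ℝ) ^ p := by gcongr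
    _ ≤ (Module.finrank K ↥(V ^ (m * (k / m))) : ℝ) := by exact_mod_cast h (k / m)
    _ ≤ _ := by exact_mod_cast Submodule.finrank_mono h3

theorem gkDim_le_of_injective {R R' : Type*} [Semiring R] [Algebra K R] [Semiring R'] [Algebra K R']
    (φ : R →ₐ[K] R') (hφ : Function.Injective φ) : gkDim K R ≤ gkDim K R' := by
  refine iSup_le ?_
  rintro ⟨V, hV, h1⟩
  refine le_trans (le_of_eq ?_) (le_iSup _ (⟨V.map φ.toLinearMap, hV.map _, ⟨1, h1, by simp⟩⟩ :
    {V : Submodule K R' // V.FG ∧ (1 : R') ∈ V}))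
  refine congrArg (fun g => limsup g atTop) (funext fun k => ?_)
  have h2 : V.map φ.toLinearMap ^ k = (V ^ k).map φ.toLinearMap := (Submodule.map_pow V φ k).symm
  have h3 : Function.Injective φ.toLinearMap := hφ
  simp only
  rw [h2, (Submodule.equivMapOfInjective _ h3 (V ^ k)).finrank_eq]

theorem gkDim_congr {R R' : Type*} [Semiring R] [Algebra K R] [Semiring R'] [Algebra K R']
    (e : R ≃ₐ[K] R') : gkDim K R = gkDim K R' :=
  le_antisymm (gkDim_le_of_injective e.toAlgHom e.injective)
    (gkDim_le_of_injective e.symm.toAlgHom e.symm.injective)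

/-- Polynomial growth of finitely generated commutative domains. -/
theorem exists_finrank_pow_le_of_algebraicIndependent_le {B : Type*} [CommRing B] [IsDomain B]
    [Algebra K B] {t : ℕ}
    (ht : ∀ (s : ℕ) (y : Fin s → B), AlgebraicIndependent K y → s ≤ t)
    {V : Submodule K B} (hV : V.FG) :
    ∃ c a : ℕ, ∀ k, Module.finrank K ↥(V ^ k) ≤ c * (a * k + a) ^ t := by
  classical
  obtain ⟨S, hS⟩ := hV
  let C : Subalgebra K B := Algebra.adjoin K (S : Set B)
  have : Algebra.FiniteType K C := ⟨(Subalgebra.fg_top C).2 ⟨S, rfl⟩⟩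
  -- Noether normalization of the algebra generated by `V`; the number `s` of polynomial variables
  -- is at most `t`.
  obtain ⟨s, g, hg, hfin⟩ := exists_finite_inj_algHom_of_fg K C
  let g' : MvPolynomial (Fin s) K →ₐ[K] B := C.val.comp g
  have hg' : Function.Injective g' := Subtype.val_injective.comp hg
  have hst : s ≤ t := by
    refine ht s (fun i => g' (MvPolynomial.X i)) ?_
    have : MvPolynomial.aeval (fun i => g' (MvPolynomial.X i)) = g' := by ext i; simp
    rw [AlgebraicIndependent, this]
    exact hg'
  -- `box m` is spanned by the monomials with all exponents at most `m`; below, `F m` is the sum of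
  -- the `box m * e i` over module generators `e i`.
  let box : ℕ → Submodule K B := fun m => Submodule.span K
    (Set.range fun α : Fin s → Fin (m + 1) => ∏ i, g' (MvPolynomial.X i) ^ (α i : ℕ))
  have box_mem : ∀ {m} (α : Fin s → ℕ), (∀ i, α i ≤ m) →
      ∏ i, g' (MvPolynomial.X i) ^ α i ∈ box m := fun α hα =>
    Submodule.subset_span ⟨fun i => ⟨α i, Nat.lt_succ_of_le (hα i)⟩, rfl⟩
  have box_mono : Monotone box := by
    intro m m' h
    refine Submodule.span_le.2 ?_
    rintro _ ⟨α, rfl⟩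
    exact box_mem _ fun i => (Nat.le_of_lt_succ (α i).2).trans h
  have box_mul : ∀ {m m' a b}, a ∈ box m → b ∈ box m' → a * b ∈ box (m + m') := by
    intro m m' a b ha hb
    refine (?_ : box m * box m' ≤ box (m + m')) (Submodule.mul_mem_mul ha hb)
    rw [Submodule.span_mul_span]
    refine Submodule.span_le.2 ?_
    rintro _ ⟨_, ⟨α, rfl⟩, _, ⟨α', rfl⟩, rfl⟩
    simp only [← Finset.prod_mul_distrib, ← pow_add]
    exact box_mem _ fun i => add_le_add (Nat.le_of_lt_succ (α i).2) (Nat.le_of_lt_succ (α' i).2)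
  have box_ex : ∀ q, ∃ m, g' q ∈ box m := by
    intro q
    induction q using MvPolynomial.induction_on with
    | C a =>
      refine ⟨0, ?_⟩
      have h := Submodule.smul_mem (box 0) a (box_mem (fun _ => 0) fun _ => le_rfl)
      rw [← MvPolynomial.algebraMap_eq, AlgHom.commutes, Algebra.algebraMap_eq_smul_one]
      simpa using h
    | add p q hp hq =>
      obtain ⟨m, hm⟩ := hp
      obtain ⟨m', hm'⟩ := hq
      refine ⟨max m m', ?_⟩
      rw [map_add]
      exact add_mem (box_mono (le_max_left _ _) hm) (box_mono (le_max_right _ _) hm')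
    | mul_X p i hp =>
      obtain ⟨m, hm⟩ := hp
      refine ⟨m + 1, ?_⟩
      rw [map_mul]
      refine box_mul hm ?_
      have h := box_mem (m := 1) (fun j => if j = i then 1 else 0) fun j => by split_ifs <;> simp
      simpa [Finset.prod_ite_eq'] using h
  have box_fin : ∀ m, Module.finrank K (box m) ≤ (m + 1) ^ s := by
    intro m
    refine (finrank_range_le_card (R := K) _).trans ?_
    simp
  have box_finite : ∀ m, Module.Finite K (box m) := fun m =>
    Module.Finite.span_of_finite K (Set.finite_range _)
  obtain ⟨n, e, he', he⟩ : ∃ (n : ℕ) (e : Fin n → B), (∀ i, e i ∈ C) ∧ ∀ b ∈ C, ∃ q : Fin n → MvPolynomial (Fin s) K,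
      ∑ i, g' (q i) * e i = b := by
    let _ := g.toRingHom.toAlgebra
    have hfin' : Module.Finite (MvPolynomial (Fin s) K) C := hfin
    obtain ⟨n, e, he⟩ := Module.Finite.exists_fin (R := MvPolynomial (Fin s) K) (M := C)
    refine ⟨n, fun i => e i, fun i => (e i).2, fun b hb => ?_⟩
    have h2 : (⟨b, hb⟩ : C) ∈ Submodule.span (MvPolynomial (Fin s) K) (Set.range e) := by
      rw [he]; trivial
    obtain ⟨q, hq⟩ := (Submodule.mem_span_range_iff_exists_fun _).1 h2
    refine ⟨q, ?_⟩
    have := congrArg C.val hq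
    rw [map_sum] at this
    exact this
  let Φ : (m : ℕ) → (Fin n → box m) →ₗ[K] B := fun m =>
    LinearMap.lsum K (fun _ => box m) K fun i => LinearMap.mulRight K (e i) ∘ₗ (box m).subtype
  have Φ_apply : ∀ m u, Φ m u = ∑ i, (u i : B) * e i := by
    intro m u; simp [Φ]
  let F : ℕ → Submodule K B := fun m => LinearMap.range (Φ m)
  have mem_F : ∀ {m} (u : Fin n → B), (∀ i, u i ∈ box m) → ∑ i, u i * e i ∈ F m :=
    fun u hu => ⟨fun i => ⟨u i, hu i⟩, Φ_apply _ _⟩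
  have F_mono : Monotone F := by
    rintro m m' h _ ⟨u, rfl⟩
    rw [Φ_apply]
    exact mem_F _ fun i => box_mono h (u i).2
  have F_mul : ∀ {m m' a b}, a ∈ box m → b ∈ F m' → a * b ∈ F (m + m') := by
    rintro m m' a _ ha ⟨u, rfl⟩
    rw [Φ_apply, Finset.mul_sum]
    simp only [← mul_assoc]
    exact mem_F _ fun i => box_mul ha (u i).2
  have F_fin : ∀ m, Module.finrank K (F m) ≤ n * (m + 1) ^ s := by
    intro m
    refine (LinearMap.finrank_range_le _).trans ?_
    rw [Module.finrank_pi_fintype]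
    simpa using Nat.mul_le_mul_left n (box_fin m)
  have F_ex : ∀ b ∈ C, ∃ m, b ∈ F m := by
    intro b hb
    obtain ⟨q, rfl⟩ := he b hb
    choose m hm using fun i => box_ex (q i)
    exact ⟨Finset.univ.sup m, mem_F _ fun i => box_mono (Finset.le_sup (Finset.mem_univ i)) (hm i)⟩
  obtain ⟨M₀, hM₀⟩ := F_ex 1 (one_mem C)
  -- Multiplication by an element of `V` thus raises the index of `F` by at most `M₁`, whence `V ^ k
  -- ≤ F (k * M₁ + M₀)`.
  obtain ⟨M₁, hM₁⟩ : ∃ M, ∀ v ∈ S, ∀ i, v * e i ∈ F M := by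
    have : ∀ v : S, ∀ i, ∃ m, (v : B) * e i ∈ F m := fun v i =>
      F_ex _ (mul_mem (Algebra.subset_adjoin v.2) (he' i))
    choose m hm using this
    refine ⟨Finset.univ.sup fun v => Finset.univ.sup (m v), fun v hv i => F_mono ?_ (hm ⟨v, hv⟩ i)⟩
    exact (Finset.le_sup (f := m ⟨v, hv⟩) (Finset.mem_univ i)).trans
      (Finset.le_sup (f := fun v => Finset.univ.sup (m v)) (Finset.mem_univ _))
  have hV' : ∀ v ∈ V, ∀ i, v * e i ∈ F M₁ := by
    intro v hv i
    rw [← hS] at hv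
    have : Submodule.span K (S : Set B) ≤ (F M₁).comap (LinearMap.mulRight K (e i)) :=
      Submodule.span_le.2 fun v hv => hM₁ v hv i
    exact this hv
  have hpow : ∀ k, V ^ k ≤ F (k * M₁ + M₀) := by
    intro k
    induction k with
    | zero => rw [pow_zero, Submodule.one_le]; simpa using hM₀
    | succ k ih =>
      rw [pow_succ', Submodule.mul_le]
      intro v hv b hb
      obtain ⟨u, rfl⟩ := ih hb
      rw [Φ_apply, Finset.mul_sum]
      refine sum_mem fun i _ => ?_
      rw [mul_left_comm]
      exact F_mono (by rw [Nat.succ_mul]; omega) (F_mul (u i).2 (hV' v hv i))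
  refine ⟨n, M₁ + M₀ + 1, fun k => ?_⟩
  refine (Submodule.finrank_mono (hpow k)).trans ((F_fin _).trans ?_)
  refine Nat.mul_le_mul_left n ?_
  have h2 : k * M₁ + M₀ + 1 ≤ (M₁ + M₀ + 1) * k + (M₁ + M₀ + 1) := by nlinarith
  exact (Nat.pow_le_pow_left h2 s).trans (Nat.pow_le_pow_right (by omega) hst)

theorem gkDim_le_of_algebraicIndependent_le {B : Type*} [CommRing B] [IsDomain B]
    [Algebra K B] {t : ℕ}
    (ht : ∀ (s : ℕ) (y : Fin s → B), AlgebraicIndependent K y → s ≤ t) :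
    gkDim K B ≤ (t : EReal) := by
  refine gkDim_le_of_finrank_pow_le t fun V hV _ => ?_
  obtain ⟨c, a, h⟩ := exists_finrank_pow_le_of_algebraicIndependent_le ht hV
  refine ⟨c * a ^ t, 1, fun k => (h k).trans (le_of_eq ?_)⟩
  rw [mul_assoc, ← mul_pow]
  ring

end GK

/-! ### Extension of derivations and Poisson brackets along formally étale maps. -/

section Extension

variable {K R S M : Type*} [CommRing K] [CommRing R] [CommRing S] [Algebra K R] [Algebra K S]
  [Algebra R S] [IsScalarTower K R S]
  [AddCommGroup M] [Module K M] [Module R M] [Module S M] [IsScalarTower R S M]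
  [IsScalarTower K S M] [IsScalarTower K R M]

/-- Derivations extend uniquely along formally étale maps. -/
theorem Derivation.existsUnique_extension [Algebra.FormallyEtale R S] (D : Derivation K R M) :
    ∃! D' : Derivation K S M, ∀ a, D' (algebraMap R S a) = D a := by
  let e := KaehlerDifferential.tensorKaehlerEquivOfFormallyEtale K R S
  -- Derivations of `S` are linear maps on `Ω[S⁄K]`, which is the base change of `Ω[R⁄K]` in the
  -- formally étale case.
  let f : TensorProduct R S (Ω[R⁄K]) →ₗ[S] M := D.liftKaehlerDifferential.liftBaseChange S
  refine ⟨(f ∘ₗ e.symm.toLinearMap).compDer (KaehlerDifferential.D K S), fun a => ?_, ?_⟩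
  · simp [f, e, KaehlerDifferential.tensorKaehlerEquivOfFormallyEtale_symm_D_algebraMap]
  · intro D' hD'
    rw [← D'.liftKaehlerDifferential_comp]
    refine congrArg (fun g : Ω[S⁄K] →ₗ[S] M => g.compDer (KaehlerDifferential.D K S)) ?_
    rw [LinearEquiv.eq_comp_toLinearMap_symm]
    ext a
    simp [f, e, hD']

theorem Derivation.ext_of_formallyEtale [Algebra.FormallyEtale R S] {D D' : Derivation K S M}
    (h : ∀ a : R, D (algebraMap R S a) = D' (algebraMap R S a)) : D = D' :=
  (Derivation.existsUnique_extension (D'.compAlgebraMap R)).unique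
    (fun a => by rw [h]; rfl) (fun _ => rfl)

end Extension

namespace PoissonStructure

variable {K : Type u} {A : Type v} [Field K] [CommRing A] [Algebra K A] {B : Type*}
  [CommRing B] [Algebra K B] [Algebra A B] [IsScalarTower K A B]

/-- The bracket as a derivation with values in derivations. -/
def hamDer (β : PoissonStructure K A) : Derivation K A (Derivation K A A) :=
  Derivation.mk'
    { toFun := β.ham
      map_add' := fun a b => by ext; simp [ham_apply]
      map_smul' := fun a b => by ext; simp [ham_apply] } fun a b => by
      ext c
      simp [ham_apply, pad_mul]

theorem ext_of_extends [Algebra.FormallyEtale A B] {β : PoissonStructure K A}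
    {γ γ' : PoissonStructure K B} (h : β.Extends γ) (h' : β.Extends γ') : γ = γ' := by
  have h1 : γ.hamDer = γ'.hamDer := by
    refine Derivation.ext_of_formallyEtale (R := A) fun a => ?_
    refine Derivation.ext_of_formallyEtale (R := A) fun b => ?_
    exact (h a b).trans (h' a b).symm
  ext a b
  exact Derivation.congr_fun (Derivation.congr_fun h1 a) b

/-- The extension is made one variable at a time: each `{a, ·}` extends to `B`, and the resulting
derivation from `A` to the derivations of `B` extends again. Skew-symmetry and Jacobi pass from `A`
to `B` by uniqueness of extensions. -/
theorem exists_extends [Algebra.FormallyEtale A B] [CharZero K] [IsDomain B]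
    (β : PoissonStructure K A) : ∃ γ : PoissonStructure K B, β.Extends γ := by
  have hchar : CharZero B := charZero_of_injective_algebraMap (algebraMap K B).injective
  choose E hE hE' using fun a => Derivation.existsUnique_extension (S := B) (M := B)
    ((Algebra.linearMap A B).compDer (β.ham a))
  have hE₀ : ∀ a b, E a (algebraMap A B b) = algebraMap A B (β.pad a b) := fun a b => hE a b
  let E₀ : Derivation K A (Derivation K B B) := Derivation.mk'
    { toFun := E
      map_add' := fun a b => Derivation.ext_of_formallyEtale (R := A) fun c => by simp [hE₀]
      map_smul' := fun a b => Derivation.ext_of_formallyEtale (R := A) fun c => by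
        simp [hE₀, algebraMap.coe_smul] } fun a b =>
      Derivation.ext_of_formallyEtale (R := A) fun c => by
        simp [hE₀, pad_mul, Algebra.smul_def]
  obtain ⟨F, hF, -⟩ := Derivation.existsUnique_extension (S := B) E₀
  have hF₀ : ∀ a b, F (algebraMap A B a) (algebraMap A B b) = algebraMap A B (β.pad a b) := by
    intro a b
    rw [hF]
    exact hE₀ a b
  -- evaluation at `b` turns derivations into derivations
  let flip : B → Derivation K B B := fun b => Derivation.mk'
    { toFun := fun a => F a b, map_add' := by simp, map_smul' := by simp } fun a a' => by simp
  have hflip : ∀ a b, flip b a = F a b := fun _ _ => rfl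
  have skew : ∀ a b, F a b = -F b a := by
    intro a b
    have h1 : ∀ (a : A) (b : B), F (algebraMap A B a) b = - F b (algebraMap A B a) := by
      intro a b
      have : F (algebraMap A B a) = -flip (algebraMap A B a) := by
        refine Derivation.ext_of_formallyEtale (R := A) fun c => ?_
        rw [Derivation.neg_apply, hflip, hF₀, hF₀, β.pad_skew, map_neg]
      rw [this]; rfl
    have : F a = -flip a := by
      refine Derivation.ext_of_formallyEtale (R := A) fun c => ?_
      rw [Derivation.neg_apply, hflip, h1, neg_neg]
    rw [this]; rfl
  have jac : ∀ a b c, F a (F b c) + F b (F c a) + F c (F a b) = 0 := by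
    -- The identity says that the derivations `⁅F a, F b⁆` and `F (F a b)` agree, so it can be
    -- tested on `A`. Cyclic symmetry then handles the three arguments in turn.
    have main : ∀ a b : B, (∀ c : A, F a (F b (algebraMap A B c)) + F b (F (algebraMap A B c) a) +
        F (algebraMap A B c) (F a b) = 0) → ∀ c, F a (F b c) + F b (F c a) + F c (F a b) = 0 := by
      intro a b h c
      have : ⁅F a, F b⁆ = F (F a b) := by
        refine Derivation.ext_of_formallyEtale (R := A) fun c => ?_
        have h1 := h c
        rw [skew (algebraMap A B c) a, skew (algebraMap A B c) (F a b), map_neg] at h1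
        rw [Derivation.commutator_apply]
        linear_combination h1
      have h2 := Derivation.congr_fun this c
      rw [Derivation.commutator_apply] at h2
      rw [skew c a, skew c (F a b), map_neg]
      linear_combination h2
    intro a b c
    refine main a b (fun c => ?_) c
    rw [add_comm, ← add_assoc]
    refine main _ a (fun b => ?_) b
    rw [add_comm, ← add_assoc]
    refine main _ _ (fun a => ?_) a
    simp only [hF₀, ← map_add]
    rw [β.jacobi, map_zero]
  refine ⟨{ pad := { toFun := fun a => (F a : B →ₗ[K] B), map_add' := fun a b => by simp,
                     map_smul' := fun a b => by simp }
            self_eq_zero := fun a => ?_, jacobi := jac, leibniz := fun a b c => ?_ }, ?_⟩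
  · have := skew a a
    exact self_eq_neg.1 this
  · simp only [LinearMap.coe_mk, AddHom.coe_mk, Derivation.coeFn_coe, Derivation.leibniz,
      smul_eq_mul]
    ring
  · exact hF₀

end PoissonStructure

/-! ### Transcendence degree, derivations and the Jacobian matrix. -/

/-- An algebraic field extension of (the fraction field of) a domain of characteristic zero is
formally étale. -/
theorem formallyEtale_of_isAlgebraic {R L : Type*} [CommRing R] [Field L] [CharZero L]
    [Algebra R L] (hinj : Function.Injective (algebraMap R L)) [Algebra.IsAlgebraic R L] :
    Algebra.FormallyEtale R L := by
  have : IsDomain R := hinj.isDomain (algebraMap R L)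
  have : FaithfulSMul R L := (faithfulSMul_iff_algebraMap_injective R L).2 hinj
  let _ : Algebra (FractionRing R) L := FractionRing.liftAlgebra R L
  have : IsScalarTower R (FractionRing R) L := FractionRing.isScalarTower_liftAlgebra R L
  have : Algebra.IsAlgebraic (FractionRing R) L :=
    (IsFractionRing.comap_isAlgebraic_iff (A := R)).1 inferInstance
  have : CharZero (FractionRing R) :=
    (algebraMap (FractionRing R) L).charZero_iff (algebraMap (FractionRing R) L).injective |>.2
      inferInstance
  have : Algebra.FormallyEtale (FractionRing R) L := Algebra.FormallyEtale.of_isSeparable _ _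
  have : Algebra.FormallyEtale R (FractionRing R) :=
    Algebra.FormallyEtale.of_isLocalization (nonZeroDivisors R)
  exact Algebra.FormallyEtale.comp R (FractionRing R) L

/-- Derivations of a field are determined by arbitrary values on a transcendence basis. -/
theorem finrank_derivation_of_isTranscendenceBasis {K L : Type*} [Field K] [Field L] [CharZero K]
    [Algebra K L] {t : ℕ} {y : Fin t → L} (hy : IsTranscendenceBasis K y) :
    Module.finrank L (Derivation K L L) = t := by
  have : CharZero L := charZero_of_injective_algebraMap (algebraMap K L).injective
  let _ : Algebra (MvPolynomial (Fin t) K) L := (MvPolynomial.aeval y).toAlgebra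
  have hmap : ∀ p, algebraMap (MvPolynomial (Fin t) K) L p = MvPolynomial.aeval y p := fun _ => rfl
  have : IsScalarTower K (MvPolynomial (Fin t) K) L := .of_algebraMap_eq fun c => by simp [hmap]
  have hinj : Function.Injective (algebraMap (MvPolynomial (Fin t) K) L) := hy.1
  have : Algebra.IsAlgebraic (MvPolynomial (Fin t) K) L := by
    have := hy.isAlgebraic
    exact Algebra.IsAlgebraic.of_ringHom_of_comp_eq (S := Algebra.adjoin K (Set.range y)) (B := L)
      hy.1.aevalEquiv (RingHom.id L) hy.1.aevalEquiv.surjective Function.injective_id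
      (by ext <;> simp [hmap])
  have := formallyEtale_of_isAlgebraic hinj
  let Φ : Derivation K L L →ₗ[L] (Fin t → L) :=
    { toFun := fun D i => D (y i), map_add' := fun _ _ => rfl, map_smul' := fun _ _ => rfl }
  have hX : ∀ i, algebraMap (MvPolynomial (Fin t) K) L (MvPolynomial.X i) = y i := by simp [hmap]
  have hΦ : Function.Bijective Φ := by
    constructor
    · intro D D' h
      refine Derivation.ext_of_formallyEtale (R := MvPolynomial (Fin t) K) fun p => ?_
      have : D.compAlgebraMap (MvPolynomial (Fin t) K) = D'.compAlgebraMap _ := by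
        refine MvPolynomial.derivation_ext fun i => ?_
        have := congrFun h i
        rw [Derivation.compAlgebraMap_apply, Derivation.compAlgebraMap_apply, hX]
        exact this
      exact Derivation.congr_fun this p
    · intro u
      obtain ⟨D, hD, -⟩ := Derivation.existsUnique_extension (S := L)
        (MvPolynomial.mkDerivation K u : Derivation K (MvPolynomial (Fin t) K) L)
      refine ⟨D, funext fun i => ?_⟩
      have := hD (MvPolynomial.X i)
      rwa [hX, MvPolynomial.mkDerivation_X] at this
  rw [(LinearEquiv.ofBijective Φ hΦ).finrank_eq]
  simp

theorem Derivation.map_mvPolynomial_aeval {K B M : Type*} [CommRing K] [CommRing B] [Algebra K B]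
    [AddCommGroup M] [Module K M] [Module B M] {n : ℕ} (D : Derivation K B M) (x : Fin n → B)
    (p : MvPolynomial (Fin n) K) :
    D (MvPolynomial.aeval x p) = ∑ j, MvPolynomial.aeval x (MvPolynomial.pderiv j p) • D (x j) := by
  classical
  induction p using MvPolynomial.induction_on with
  | C a => simp
  | add p q hp hq => simp only [map_add, hp, hq, add_smul, Finset.sum_add_distrib]
  | mul_X p i hp =>
    simp [hp, Derivation.leibniz, add_smul, Finset.sum_add_distrib, Finset.smul_sum, smul_smul,
      MvPolynomial.pderiv_X, Pi.single_apply, apply_ite, ite_smul]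

theorem presentationMap_eq_aeval {K : Type*} [Field K] {n m : ℕ}
    (f : Fin m → MvPolynomial (Fin n) K) (A : Type*) [CommRing A] [Algebra K A]
    [Algebra (AffineAlg f) A] [IsScalarTower K (AffineAlg f) A] (p : MvPolynomial (Fin n) K) :
    presentationMap f A p = MvPolynomial.aeval (coordinate f A) p := by
  have : presentationMap f A = (MvPolynomial.aeval (R := K) (coordinate f A)).toRingHom := by
    refine MvPolynomial.ringHom_ext (fun c => ?_) fun i => ?_
    · have h1 : presentationMap f A (MvPolynomial.C c) = algebraMap K A c := by
        rw [IsScalarTower.algebraMap_apply K (AffineAlg f) A]; rfl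
      rw [h1]; simp
    · simp [coordinate]
  rw [this]; rfl

/-- Derivations of a field that is algebraic over an affine domain are the vectors killed by
the Jacobian matrix. -/
theorem rank_jacobian_add_finrank_derivation {K L : Type*} [Field K] [Field L] [CharZero K]
    [Algebra K L] {n m : ℕ} (f : Fin m → MvPolynomial (Fin n) K) [Algebra (AffineAlg f) L]
    [IsScalarTower K (AffineAlg f) L] (hinj : Function.Injective (algebraMap (AffineAlg f) L))
    [Algebra.IsAlgebraic (AffineAlg f) L] :
    (jacobianMat f L).rank + Module.finrank L (Derivation K L L) = n := by
  have : CharZero L := charZero_of_injective_algebraMap (algebraMap K L).injective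
  have := formallyEtale_of_isAlgebraic hinj
  have hzero : ∀ i, presentationMap f L (f i) = 0 := by
    intro i
    have : Ideal.Quotient.mk (Ideal.span (Set.range f)) (f i) = 0 :=
      Ideal.Quotient.eq_zero_iff_mem.2 (Ideal.subset_span ⟨i, rfl⟩)
    rw [presentationMap, RingHom.comp_apply, this, map_zero]
  have chain : ∀ (D : Derivation K L L) p, D (presentationMap f L p) =
      ∑ j, presentationMap f L (MvPolynomial.pderiv j p) * D (coordinate f L j) := by
    intro D p
    simp only [presentationMap_eq_aeval]
    exact D.map_mvPolynomial_aeval _ p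
  let Φ : Derivation K L L →ₗ[L] (Fin n → L) :=
    { toFun := fun D i => D (coordinate f L i), map_add' := fun _ _ => rfl,
      map_smul' := fun _ _ => rfl }
  have hΦ : Function.Injective Φ := by
    intro D D' h
    refine Derivation.ext_of_formallyEtale (R := AffineAlg f) fun a => ?_
    obtain ⟨p, rfl⟩ := Ideal.Quotient.mk_surjective a
    have h1 := chain D p
    have h2 : ∀ j, D (coordinate f L j) = D' (coordinate f L j) := fun j => congrFun h j
    simp only [h2] at h1
    rw [← chain D' p] at h1
    exact h1
  have hrange : LinearMap.range Φ = LinearMap.ker (jacobianMat f L).mulVecLin := by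
    apply le_antisymm
    · rintro _ ⟨D, rfl⟩
      rw [LinearMap.mem_ker]
      ext i
      have := chain D (f i)
      rw [hzero, map_zero] at this
      exact this.symm
    -- A vector killed by the Jacobian matrix gives a derivation of the polynomial ring vanishing on
    -- the `f i`, hence on the ideal; it descends to the quotient and extends to `L`.
    · intro v hv
      let _ : Algebra (MvPolynomial (Fin n) K) L := (presentationMap f L).toAlgebra
      have : IsScalarTower K (MvPolynomial (Fin n) K) L := .of_algebraMap_eq fun c => by
        rw [IsScalarTower.algebraMap_apply K (AffineAlg f) L]; rfl
      have hmap : ∀ (p : MvPolynomial (Fin n) K) (z : L), p • z = presentationMap f L p * z :=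
        fun _ _ => rfl
      let D₀ : Derivation K (MvPolynomial (Fin n) K) L := MvPolynomial.mkDerivation K v
      have hD₀ : ∀ p, D₀ p = ∑ j, presentationMap f L (MvPolynomial.pderiv j p) * v j := by
        intro p
        have := D₀.map_mvPolynomial_aeval MvPolynomial.X p
        rw [MvPolynomial.aeval_X_left_apply] at this
        simpa [D₀, hmap, MvPolynomial.mkDerivation_X] using this
      have hI : ∀ p ∈ Ideal.span (Set.range f), D₀ p = 0 := by
        intro p hp
        induction hp using Submodule.span_induction with
        | mem p h =>
          obtain ⟨i, rfl⟩ := h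
          rw [hD₀]
          exact congrFun hv i
        | zero => exact map_zero _
        | add p q _ _ hp hq => rw [map_add, hp, hq, add_zero]
        | smul p q hq' hq =>
          have : presentationMap f L q = 0 := by
            rw [presentationMap, RingHom.comp_apply, Ideal.Quotient.eq_zero_iff_mem.2 hq', map_zero]
          rw [smul_eq_mul, Derivation.leibniz, hq, smul_zero, hmap, this, zero_mul, add_zero]
      let D₁ : AffineAlg f →ₗ[K] L :=
        ((Ideal.span (Set.range f)).restrictScalars K).liftQ (D₀ : MvPolynomial (Fin n) K →ₗ[K] L)
          (fun p hp => hI p hp) ∘ₗ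
          (Submodule.Quotient.restrictScalarsEquiv K (Ideal.span (Set.range f))).symm.toLinearMap
      have hD₁ : ∀ p, D₁ (Ideal.Quotient.mk _ p) = D₀ p := fun p => rfl
      obtain ⟨D, hD, -⟩ := Derivation.existsUnique_extension (S := L)
        (Derivation.mk' D₁ fun a b => by
          obtain ⟨p, rfl⟩ := Ideal.Quotient.mk_surjective a
          obtain ⟨q, rfl⟩ := Ideal.Quotient.mk_surjective b
          rw [← map_mul, hD₁, hD₁, hD₁, Derivation.leibniz, Algebra.smul_def,
            Algebra.smul_def, Algebra.smul_def, Algebra.smul_def]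
          rfl)
      refine ⟨D, funext fun i => (hD _).trans ?_⟩
      exact (hD₁ _).trans (MvPolynomial.mkDerivation_X _ _ _)
  have h1 := (jacobianMat f L).mulVecLin.finrank_range_add_finrank_ker
  rw [← hrange, LinearMap.finrank_range_of_inj hΦ] at h1
  simpa [Matrix.rank] using h1

/-- Every element is a quotient of polynomials in `x` with invertible denominator. -/
def IsEssentiallyGenerated (K : Type*) [Field K] {B : Type*} [CommRing B] [Algebra K B] {n : ℕ}
    (x : Fin n → B) : Prop :=
  ∀ b : B, ∃ p q : MvPolynomial (Fin n) K,
    IsUnit (MvPolynomial.aeval x q) ∧ b * MvPolynomial.aeval x q = MvPolynomial.aeval x p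

theorem IsEssentiallyGenerated.of_isLocalization {K A B : Type*} [Field K] [CommRing A]
    [Algebra K A] [CommRing B] [Algebra K B] [Algebra A B] [IsScalarTower K A B] {n : ℕ}
    {x : Fin n → A} (hx : IsEssentiallyGenerated K x) (S : Submonoid A) [IsLocalization S B] :
    IsEssentiallyGenerated K fun i => algebraMap A B (x i) := by
  have haeval : ∀ p : MvPolynomial (Fin n) K, MvPolynomial.aeval (fun i => algebraMap A B (x i)) p =
      algebraMap A B (MvPolynomial.aeval x p) := fun p => by
    rw [← MvPolynomial.aeval_algebraMap_apply]; rfl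
  intro b
  obtain ⟨⟨a, s⟩, h⟩ := IsLocalization.surj S b
  obtain ⟨p, q, hq, hpq⟩ := hx a
  obtain ⟨p', q', hq', hpq'⟩ := hx s
  have hs : IsUnit (algebraMap A B s) := IsLocalization.map_units B s
  refine ⟨p * q', q * p', ?_, ?_⟩
  · rw [haeval, map_mul, ← hpq', map_mul, map_mul]
    exact (hq.map _).mul (hs.mul (hq'.map _))
  · simp only at h
    rw [haeval, haeval, map_mul, map_mul, map_mul, ← hpq', ← hpq]
    simp only [map_mul, ← h]
    ring

theorem IsEssentiallyGenerated.isAlgebraic {K L R : Type*} [Field K] [Field L] [Algebra K L]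
    [CommRing R] [IsDomain R] [Algebra R L] {n : ℕ} {x : Fin n → L}
    (hx : IsEssentiallyGenerated K x)
    (h : ∀ p : MvPolynomial (Fin n) K, ∃ c, algebraMap R L c = MvPolynomial.aeval x p) (l : L) :
    IsAlgebraic R l := by
  obtain ⟨p, q, hq, hpq⟩ := hx l
  obtain ⟨c, hc⟩ := h p
  obtain ⟨b, hb⟩ := h q
  rw [← eq_mul_inv_iff_mul_eq₀ hq.ne_zero, ← hc, ← hb] at hpq
  rw [hpq]
  exact (isAlgebraic_algebraMap c).mul (isAlgebraic_algebraMap b).inv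

theorem isEssentiallyGenerated_coordinate {K : Type*} [Field K] {n m : ℕ}
    (f : Fin m → MvPolynomial (Fin n) K) (S : Submonoid (AffineAlg f)) (A : Type*) [CommRing A]
    [Algebra K A] [Algebra (AffineAlg f) A] [IsScalarTower K (AffineAlg f) A] [IsLocalization S A] :
    IsEssentiallyGenerated K (coordinate f A) := by
  have h0 : IsEssentiallyGenerated K
      (fun i => (Ideal.Quotient.mk (Ideal.span (Set.range f)) (MvPolynomial.X i) : AffineAlg f)) := by
    intro b
    obtain ⟨p, rfl⟩ := Ideal.Quotient.mk_surjective b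
    refine ⟨p, 1, by simp, ?_⟩
    rw [map_one, mul_one]
    have := MvPolynomial.aeval_algebraMap_apply (AffineAlg f)
      (MvPolynomial.X : Fin n → MvPolynomial (Fin n) K) p
    rw [MvPolynomial.aeval_X_left_apply] at this
    exact this.symm
  exact h0.of_isLocalization S

/-- The transcendence degree of an essentially affine domain is read off from the Jacobian
matrix, and it is attained by some of the coordinates. -/
theorem exists_isTranscendenceBasis_coordinate {K : Type*} [Field K] [CharZero K] {n m : ℕ}
    (f : Fin m → MvPolynomial (Fin n) K) (hI : (Ideal.span (Set.range f)).IsPrime)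
    (S : Submonoid (AffineAlg f)) (A : Type*) [CommRing A] [IsDomain A]
    [Algebra K A] [Algebra (AffineAlg f) A] [IsScalarTower K (AffineAlg f) A] [IsLocalization S A] :
    ∃ (t : ℕ) (s : Fin t → Fin n),
      IsTranscendenceBasis K (fun i => algebraMap A (FractionRing A) (coordinate f A (s i))) ∧
      fracRank (jacobianMat f A) + t = n := by
  have : IsDomain (AffineAlg f) := (Ideal.Quotient.isDomain_iff_prime _).2 hI
  have hinj₀ : Function.Injective (algebraMap (AffineAlg f) A) :=
    IsLocalization.injective A (M := S) (le_nonZeroDivisors_of_noZeroDivisors fun h0 => by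
      have := IsLocalization.map_units A (⟨0, h0⟩ : S)
      simp at this)
  let L := FractionRing A
  have hinj : Function.Injective (algebraMap (AffineAlg f) L) := by
    rw [IsScalarTower.algebraMap_eq (AffineAlg f) A L]
    exact (IsFractionRing.injective A L).comp hinj₀
  have hx : IsEssentiallyGenerated K fun i => algebraMap A L (coordinate f A i) :=
    (isEssentiallyGenerated_coordinate f S A).of_isLocalization (nonZeroDivisors A)
  have hcoord : (fun i => algebraMap A L (coordinate f A i)) = coordinate f L := by
    funext i
    simp only [coordinate, presentationMap, RingHom.comp_apply]
    rw [IsScalarTower.algebraMap_apply (AffineAlg f) A L]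
  rw [hcoord] at hx
  have : Algebra.IsAlgebraic (AffineAlg f) L := ⟨fun l => hx.isAlgebraic (fun p =>
    ⟨Ideal.Quotient.mk _ p, presentationMap_eq_aeval f L p⟩) l⟩
  have : Algebra.IsAlgebraic (Algebra.adjoin K (Set.range (coordinate f L))) L :=
    ⟨fun l => hx.isAlgebraic (fun p => by
      refine ⟨⟨MvPolynomial.aeval (coordinate f L) p, ?_⟩, rfl⟩
      rw [Algebra.adjoin_range_eq_range_aeval]
      exact ⟨p, rfl⟩) l⟩
  -- The basis is taken among the coordinates so that it lies in `A`, as the lower bounds on growth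
  -- require.
  obtain ⟨U, hU, hUb⟩ := exists_isTranscendenceBasis_subset (R := K) (Set.range (coordinate f L))
  have hUfin : Finite U := (Set.finite_range _).subset hU
  let e : Fin (Nat.card U) ≃ U := (Finite.equivFin U).symm
  choose s hs using fun i => hU (e i).2
  have hb : IsTranscendenceBasis K fun i => coordinate f L (s i) := by
    have := hUb.comp_equiv e
    convert this using 1
    funext i
    exact hs i
  refine ⟨Nat.card U, s, ?_, ?_⟩
  · have h1 : ∀ i, algebraMap A L (coordinate f A i) = coordinate f L i := congrFun hcoord
    simp only [L] at h1
    simp only [h1]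
    exact hb
  · have h1 := rank_jacobian_add_finrank_derivation f hinj
    rw [finrank_derivation_of_isTranscendenceBasis hb] at h1
    have h2 : (jacobianMat f A).map (algebraMap A L) = jacobianMat f L := by
      ext i j
      simp only [jacobianMat, presentationMap, RingHom.comp_apply, Matrix.map_apply, Matrix.of_apply]
      rw [IsScalarTower.algebraMap_apply (AffineAlg f) A L]
    rw [fracRank, h2, h1]

theorem IsTranscendenceBasis.le_of_algebraicIndependent {K L : Type*} [Field K] [Field L]
    [Algebra K L] {t : ℕ} {y : Fin t → L} (hy : IsTranscendenceBasis K y) {s : ℕ} {z : Fin s → L}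
    (hz : AlgebraicIndependent K z) : s ≤ t := by
  have h1 := hz.lift_cardinalMk_le_trdeg
  rw [← hy.lift_cardinalMk_eq_trdeg] at h1
  simpa using h1

/-! ### Cramer's rule and finitely generated subalgebras stable under derivations. -/

/-- Cramer's rule for the rows of a matrix of rank `d` with respect to a nonzero minor. -/
theorem exists_det_mul_eq_sum_of_fracRank {A : Type*} [CommRing A] [IsDomain A] {m n d : ℕ}
    (M : Matrix (Fin m) (Fin n) A) (hM : fracRank M = d) (i : Fin d → Fin m) (j : Fin d → Fin n)
    (hdet : (M.submatrix i j).det ≠ 0) (l : Fin m) :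
    ∃ c : Fin d → A, ∀ q, (M.submatrix i j).det * M l q = ∑ s, c s * M (i s) q := by
  let F := FractionRing A
  let M' : Matrix (Fin m) (Fin n) F := M.map (algebraMap A F)
  let N' : Matrix (Fin d) (Fin d) F := M'.submatrix i j
  have hinj : Function.Injective (algebraMap A F) := IsFractionRing.injective A F
  have hN' : N' = (M.submatrix i j).map (algebraMap A F) := rfl
  have hdetN' : N'.det = algebraMap A F (M.submatrix i j).det := by
    rw [hN']; exact ((algebraMap A F).map_det _).symm
  have hadj : N'.adjugate = (M.submatrix i j).adjugate.map (algebraMap A F) := by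
    rw [hN']; exact ((algebraMap A F).map_adjugate _).symm
  have hdet' : N'.det ≠ 0 := by
    rw [hdetN']; exact (map_ne_zero_iff _ hinj).2 hdet
  have hrows : LinearIndependent F fun s => M'.row (i s) := by
    have h1 : LinearIndependent F N'.row := Matrix.linearIndependent_rows_of_det_ne_zero hdet'
    exact LinearIndependent.of_comp (LinearMap.funLeft F F j) h1
  have hspan : Submodule.span F (Set.range fun s => M'.row (i s)) =
      Submodule.span F (Set.range M'.row) := by
    refine Submodule.eq_of_le_of_finrank_eq
      (Submodule.span_mono (Set.range_comp_subset_range i M'.row)) ?_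
    rw [finrank_span_eq_card hrows, ← Matrix.rank_eq_finrank_span_row, Fintype.card_fin]
    exact hM.symm
  have hl : M'.row l ∈ Submodule.span F (Set.range fun s => M'.row (i s)) := by
    rw [hspan]; exact Submodule.subset_span ⟨l, rfl⟩
  obtain ⟨c, hc⟩ := (Submodule.mem_span_range_iff_exists_fun F).1 hl
  have hc' : ∀ q, M' l q = ∑ s, c s * M' (i s) q := by
    intro q
    have := congrFun hc q
    simpa using this.symm
  have hv : (fun t => M' l (j t)) = Matrix.vecMul c N' := by
    funext t
    rw [hc']; rfl
  have hv' : Matrix.vecMul (fun t => M' l (j t)) N'.adjugate = N'.det • c := by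
    rw [hv, Matrix.vecMul_vecMul, Matrix.mul_adjugate, Matrix.vecMul_smul, Matrix.vecMul_one]
  -- The adjugate puts the coefficients in `A`; over the fraction field they equal the minor times
  -- the coefficients `c` of the row.
  refine ⟨Matrix.vecMul (fun t => M l (j t)) (M.submatrix i j).adjugate, fun q => hinj ?_⟩
  have h2 : ∀ s, algebraMap A F (Matrix.vecMul (fun t => M l (j t)) (M.submatrix i j).adjugate s) =
      N'.det * c s := by
    intro s
    have := congrFun hv' s
    rw [hadj] at this
    simp only [Pi.smul_apply, smul_eq_mul] at this
    rw [← this]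
    simp [Matrix.vecMul, dotProduct, M']
  rw [map_mul, map_sum, ← hdetN']
  have h3 : algebraMap A F (M l q) = M' l q := rfl
  simp only [map_mul, h2]
  rw [h3, hc', Finset.mul_sum]
  exact Finset.sum_congr rfl fun s _ => by simp [M', mul_assoc]

theorem Derivation.finset_sum_apply {K B M ι : Type*} [CommRing K] [CommRing B] [Algebra K B]
    [AddCommGroup M] [Module K M] [Module B M] (S : Finset ι) (D : ι → Derivation K B M) (b : B) :
    (∑ i ∈ S, D i) b = ∑ i ∈ S, D i b := by
  classical
  induction S using Finset.induction_on with
  | empty => simp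
  | insert i S hi ih => rw [Finset.sum_insert hi, Finset.sum_insert hi, Derivation.add_apply, ih]

namespace IsEssentiallyGenerated

variable {K B : Type*} [Field K] [CommRing B] [Algebra K B] {n : ℕ} {x : Fin n → B}

/-- Applying `D` to `b q(x) = p(x)` leaves `q(x) D b = 0` with `q(x)` invertible. -/
theorem derivation_eq_zero (hx : IsEssentiallyGenerated K x) {M : Type*} [AddCommGroup M]
    [Module K M] [Module B M] (D : Derivation K B M) (h : ∀ i, D (x i) = 0) : D = 0 := by
  have hpoly : ∀ p : MvPolynomial (Fin n) K, D (MvPolynomial.aeval x p) = 0 := fun p => by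
    rw [D.map_mvPolynomial_aeval]; simp [h]
  ext b
  obtain ⟨p, q, hq, hpq⟩ := hx b
  have h1 := congrArg D hpq
  rw [Derivation.leibniz, hpoly, hpoly, smul_zero, zero_add] at h1
  exact (hq.smul_eq_zero).1 h1

/-- Finitely many elements have a common denominator. -/
theorem exists_common_denominator (hx : IsEssentiallyGenerated K x) (E : Finset B) :
    ∃ q : MvPolynomial (Fin n) K, IsUnit (MvPolynomial.aeval x q) ∧
      ∀ e ∈ E, ∃ p : MvPolynomial (Fin n) K,
        e * MvPolynomial.aeval x q = MvPolynomial.aeval x p := by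
  classical
  induction E using Finset.induction_on with
  | empty => exact ⟨1, by simp, by simp⟩
  | insert b E _ ih =>
    obtain ⟨q, hq, h⟩ := ih
    obtain ⟨p', q', hq', hpq'⟩ := hx b
    refine ⟨q * q', by rw [map_mul]; exact hq.mul hq', fun e he => ?_⟩
    rcases Finset.mem_insert.1 he with rfl | he
    · exact ⟨p' * q, by rw [map_mul, map_mul, ← hpq']; ring⟩
    · obtain ⟨p, hp⟩ := h e he
      exact ⟨p * q', by rw [map_mul, map_mul, ← hp]; ring⟩

end IsEssentiallyGenerated

theorem Submodule.pow_mono_of_one_mem {K B : Type*} [Field K] [Ring B] [Algebra K B]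
    {W : Submodule K B} (h1 : 1 ∈ W) : Monotone fun k => W ^ k :=
  fun _ _ h => pow_le_pow_right₀ (Submodule.one_le.2 h1) h

theorem exists_mem_pow_of_mem_adjoin {K B : Type*} [Field K] [CommRing B] [Algebra K B]
    {W : Submodule K B} (h1 : 1 ∈ W) {b : B} (hb : b ∈ Algebra.adjoin K (W : Set B)) :
    ∃ k, b ∈ W ^ k := by
  have hmono := Submodule.pow_mono_of_one_mem h1
  induction hb using Algebra.adjoin_induction with
  | mem b hb => exact ⟨1, by simpa using hb⟩
  | algebraMap c => exact ⟨0, by rw [pow_zero]; exact Submodule.algebraMap_mem c⟩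
  | add a b _ _ ha hb =>
    obtain ⟨k, hk⟩ := ha
    obtain ⟨k', hk'⟩ := hb
    exact ⟨max k k', add_mem (hmono (le_max_left _ _) hk) (hmono (le_max_right _ _) hk')⟩
  | mul a b _ _ ha hb =>
    obtain ⟨k, hk⟩ := ha
    obtain ⟨k', hk'⟩ := hb
    exact ⟨k + k', by rw [pow_add]; exact Submodule.mul_mem_mul hk hk'⟩

theorem derivation_mem_pow_add {K B : Type*} [Field K] [CommRing B] [Algebra K B]
    {W : Submodule K B} {N : ℕ} (D : Derivation K B B) (hD : ∀ a ∈ W, D a ∈ W ^ (N + 1)) (k : ℕ) :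
    ∀ a ∈ W ^ k, D a ∈ W ^ (k + N) := by
  induction k with
  | zero =>
    intro a ha
    rw [pow_zero, Submodule.mem_one] at ha
    obtain ⟨c, rfl⟩ := ha
    rw [Derivation.map_algebraMap]
    exact zero_mem _
  | succ k ih =>
    intro a ha
    rw [pow_succ] at ha
    induction ha using Submodule.mul_induction_on' with
    | mem_mul_mem a ha b hb =>
      rw [Derivation.leibniz, smul_eq_mul, smul_eq_mul]
      refine add_mem ?_ ?_
      · rw [show k + 1 + N = k + (N + 1) by ring, pow_add]
        exact Submodule.mul_mem_mul ha (hD b hb)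
      · rw [show k + 1 + N = (k + N) + 1 by ring, pow_succ']
        exact Submodule.mul_mem_mul hb (ih a ha)
    | add a _ b _ ha hb => rw [map_add]; exact add_mem ha hb

/-- Finitely many derivations and elements live on a finitely generated subalgebra. -/
theorem IsEssentiallyGenerated.exists_isAdaptedFiltration {K B : Type*} [Field K] [CommRing B]
    [Algebra K B] {n : ℕ} {x : Fin n → B} (hx : IsEssentiallyGenerated K x) {d : ℕ}
    (δ : Fin d → Derivation K B B)
    (hcomm : ∀ s t, ∃ c : Fin d → B,
      ((δ s : B →ₗ[K] B) : Module.End K B) * (δ t : B →ₗ[K] B) -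
        ((δ t : B →ₗ[K] B) : Module.End K B) * (δ s : B →ₗ[K] B) =
        ∑ v, c v • ((δ v : B →ₗ[K] B) : Module.End K B)) (E : Finset B) :
    ∃ (W : Submodule K B) (N : ℕ), W.FG ∧ 1 ∈ W ∧ 0 < N ∧ (∀ e ∈ E, ∃ k, e ∈ W ^ k) ∧
      IsAdaptedFiltration δ (fun k => W ^ k) N := by
  classical
  choose c hc using hcomm
  -- All elements that the subalgebra must contain: the prescribed ones, the values of the
  -- derivations on the coordinates, and the structure coefficients of the commutators.
  let E' : Finset B := E ∪ (Finset.univ.image fun p : Fin d × Fin n => δ p.1 (x p.2)) ∪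
    (Finset.univ.image fun p : Fin d × Fin d × Fin d => c p.1 p.2.1 p.2.2)
  obtain ⟨q, hq, hE'⟩ := hx.exists_common_denominator E'
  obtain ⟨v, hv⟩ := hq.exists_right_inv
  let G : Set B := insert 1 (insert v (Set.range x))
  have hG : G.Finite := ((Set.finite_range x).insert v).insert 1
  let W : Submodule K B := Submodule.span K G
  have h1 : (1 : B) ∈ W := Submodule.subset_span (Or.inl rfl)
  have hvW : v ∈ W := Submodule.subset_span (Or.inr (Or.inl rfl))
  have hxW : ∀ i, x i ∈ W := fun i => Submodule.subset_span (Or.inr (Or.inr ⟨i, rfl⟩))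
  let C : Subalgebra K B := Algebra.adjoin K (W : Set B)
  have hWC : ∀ {a}, a ∈ W → a ∈ C := fun h => Algebra.subset_adjoin h
  have hpoly : ∀ p : MvPolynomial (Fin n) K, MvPolynomial.aeval x p ∈ C := by
    intro p
    have : MvPolynomial.aeval x p ∈ Algebra.adjoin K (Set.range x) := by
      rw [Algebra.adjoin_range_eq_range_aeval]; exact ⟨p, rfl⟩
    exact Algebra.adjoin_mono (by rintro _ ⟨i, rfl⟩; exact hxW i) this
  have hE'C : ∀ e ∈ E', e ∈ C := by
    intro e he
    obtain ⟨p, hp⟩ := hE' e he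
    have : e = MvPolynomial.aeval x p * v := by rw [← hp, mul_assoc, hv, mul_one]
    rw [this]
    exact mul_mem (hpoly p) (hWC hvW)
  have hδx : ∀ s i, δ s (x i) ∈ C := fun s i => hE'C _ (by
    simp only [E', Finset.mem_union, Finset.mem_image, Finset.mem_univ, true_and]
    exact Or.inl (Or.inr ⟨(s, i), rfl⟩))
  have hcC : ∀ s t u, c s t u ∈ C := fun s t u => hE'C _ (by
    simp only [E', Finset.mem_union, Finset.mem_image, Finset.mem_univ, true_and]
    exact Or.inr ⟨(s, t, u), rfl⟩)
  have hδv : ∀ s, δ s v ∈ C := by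
    intro s
    have h2 := congrArg (δ s) hv
    rw [Derivation.leibniz, Derivation.map_one_eq_zero, smul_eq_mul, smul_eq_mul] at h2
    -- The quotient rule for the inverse `v` of the common denominator: adjoining `v` keeps the
    -- subalgebra stable.
    have h3 : δ s v = -(v * v * δ s (MvPolynomial.aeval x q)) := by
      linear_combination v * h2 - δ s v * hv
    rw [h3, Derivation.map_mvPolynomial_aeval]
    refine neg_mem (mul_mem (mul_mem (hWC hvW) (hWC hvW)) (sum_mem fun i _ => ?_))
    exact mul_mem (hpoly _) (hδx s i)
  have hmono := Submodule.pow_mono_of_one_mem h1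
  obtain ⟨N₁, hN₁⟩ : ∃ N, ∀ s, ∀ g ∈ G, δ s g ∈ W ^ N := by
    have : ∀ (s : Fin d) (g : hG.toFinset), ∃ k, δ s g ∈ W ^ k := by
      rintro s ⟨g, hg⟩
      refine exists_mem_pow_of_mem_adjoin h1 ?_
      rw [Set.Finite.mem_toFinset] at hg
      rcases hg with rfl | rfl | ⟨i, rfl⟩
      · simp
      · exact hδv s
      · exact hδx s i
    choose k hk using this
    refine ⟨Finset.univ.sup fun p : Fin d × hG.toFinset => k p.1 p.2, fun s g hg => ?_⟩
    exact hmono (Finset.le_sup (f := fun p : Fin d × hG.toFinset => k p.1 p.2)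
      (Finset.mem_univ (s, ⟨g, hG.mem_toFinset.2 hg⟩))) (hk s ⟨g, hG.mem_toFinset.2 hg⟩)
  obtain ⟨N₂, hN₂⟩ : ∃ N, ∀ s t u, c s t u ∈ W ^ N := by
    choose k hk using fun p : Fin d × Fin d × Fin d =>
      exists_mem_pow_of_mem_adjoin h1 (hcC p.1 p.2.1 p.2.2)
    exact ⟨Finset.univ.sup k, fun s t u =>
      hmono (Finset.le_sup (Finset.mem_univ (s, t, u))) (hk (s, t, u))⟩
  have hWN : ∀ s, ∀ a ∈ W, δ s a ∈ W ^ (N₁ + N₂ + 1 + 1) := by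
    intro s a ha
    have : W ≤ (W ^ (N₁ + N₂ + 1 + 1)).comap (δ s : B →ₗ[K] B) :=
      Submodule.span_le.2 fun g hg => hmono (show N₁ ≤ N₁ + N₂ + 1 + 1 by omega) (hN₁ s g hg)
    exact this ha
  -- The weight dominates both the growth under the derivations and the structure coefficients; the
  -- `+ 1` makes it positive.
  refine ⟨W, N₁ + N₂ + 1, Submodule.fg_span hG, h1, by omega, fun e he =>
    exists_mem_pow_of_mem_adjoin h1 (hE'C e (by simp [E', he])), hmono, ?_, ?_, ?_, ?_⟩
  · rw [pow_zero]; exact Submodule.one_le.1 le_rfl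
  · intro i j a b ha hb
    rw [pow_add]
    exact Submodule.mul_mem_mul ha hb
  · exact fun s i a ha => derivation_mem_pow_add (δ s) (hWN s) i a ha
  · exact fun s t => ⟨c s t, fun u => hmono (by omega) (hN₂ s t u), hc s t⟩

/-- An operator lies in the filtration as soon as its coefficients do. -/
theorem exists_finset_forall_mem_wordFiltration {K B : Type*} [Field K] [CommRing B]
    [Algebra K B] {d : ℕ} (δ : Fin d → Derivation K B B) {P : Module.End K B}
    (hP : P ∈ Submodule.span B (Set.range (derivWord δ))) :
    ∃ E : Finset B, ∀ (w : ℕ → Submodule K B) (N : ℕ), IsAdaptedFiltration δ w N →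
      (∀ e ∈ E, ∃ k, e ∈ w k) → ∃ k, P ∈ wordFiltration δ w N k k := by
  classical
  induction hP using Submodule.span_induction with
  | mem P h =>
    obtain ⟨l, rfl⟩ := h
    refine ⟨∅, fun w N H _ => ⟨N * l.length + l.length, ?_⟩⟩
    rw [← one_smul B (derivWord δ l)]
    exact smul_derivWord_mem_wordFiltration H.one_mem (by omega) (by omega)
  | zero => exact ⟨∅, fun w N _ _ => ⟨0, zero_mem _⟩⟩
  | add P Q _ _ hP hQ =>
    obtain ⟨E, hE⟩ := hP
    obtain ⟨E', hE'⟩ := hQ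
    refine ⟨E ∪ E', fun w N H h => ?_⟩
    obtain ⟨k, hk⟩ := hE w N H fun e he => h e (Finset.mem_union_left _ he)
    obtain ⟨k', hk'⟩ := hE' w N H fun e he => h e (Finset.mem_union_right _ he)
    exact ⟨max k k', add_mem (wordFiltration_mono (le_max_left _ _) (le_max_left _ _) hk)
      (wordFiltration_mono (le_max_right _ _) (le_max_right _ _) hk')⟩
  | smul b P _ hP =>
    obtain ⟨E, hE⟩ := hP
    refine ⟨insert b E, fun w N H h => ?_⟩
    obtain ⟨k, hk⟩ := hE w N H fun e he => h e (Finset.mem_insert_of_mem he)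
    obtain ⟨j, hj⟩ := h b (Finset.mem_insert_self _ _)
    exact ⟨j + k, wordFiltration_mono le_rfl (by omega) (H.smul_mem hj hk)⟩

/-! ### Generators of the operator algebra and the upper bound on its growth. -/

namespace PoissonStructure

variable {K : Type u} {B : Type v} [Field K] [CommRing B] [Algebra K B]

/-- Since `b ↦ {b, ·}` is a derivation, the chain rule handles polynomials in `x`, and the product
rule for `b q(x) = p(x)` handles quotients. -/
theorem pad_mem_span_pad_generators (γ : PoissonStructure K B) {n : ℕ} {x : Fin n → B}
    (hx : IsEssentiallyGenerated K x) (b : B) :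
    γ.pad b ∈ Submodule.span B (Set.range fun l => γ.pad (x l)) := by
  have hpoly : ∀ p : MvPolynomial (Fin n) K,
      γ.pad (MvPolynomial.aeval x p) ∈ Submodule.span B (Set.range fun l => γ.pad (x l)) := by
    intro p
    have h1 := γ.hamDer.map_mvPolynomial_aeval x p
    have h2 : γ.pad (MvPolynomial.aeval x p) =
        ∑ j, MvPolynomial.aeval x (MvPolynomial.pderiv j p) • γ.pad (x j) := by
      ext c
      have h3 := Derivation.congr_fun h1 c
      rw [Derivation.finset_sum_apply] at h3
      rw [LinearMap.sum_apply]
      exact h3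
    rw [h2]
    exact sum_mem fun j _ => Submodule.smul_mem _ _ (Submodule.subset_span ⟨j, rfl⟩)
  obtain ⟨p, q, hq, hpq⟩ := hx b
  have h1 := hpoly p
  rw [← hpq, γ.pad_mul] at h1
  have h2 := (Submodule.add_mem_iff_right _ (Submodule.smul_mem _ b (hpoly q))).1 h1
  exact (Submodule.smul_mem_iff_of_isUnit _ hq).1 h2

/-- If some of the rows of the bracket matrix generate all its rows, then the corresponding
Hamiltonian derivations generate all Hamiltonian derivations. -/
theorem pad_mem_span_pad (γ : PoissonStructure K B) {n d : ℕ} {x : Fin n → B}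
    (hx : IsEssentiallyGenerated K x) (i : Fin d → Fin n) {μ : B} (hμ : IsUnit μ)
    (h : ∀ l, ∃ c : Fin d → B, ∀ q,
      μ * γ.pad (x l) (x q) = ∑ s, c s * γ.pad (x (i s)) (x q)) (b : B) :
    γ.pad b ∈ Submodule.span B (Set.range fun s => γ.pad (x (i s))) := by
  refine Submodule.span_le.2 ?_ (γ.pad_mem_span_pad_generators hx b)
  rintro _ ⟨l, rfl⟩
  obtain ⟨c, hc⟩ := h l
  have h1 : μ • γ.ham (x l) - ∑ s, c s • γ.ham (x (i s)) = 0 := by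
    refine hx.derivation_eq_zero _ fun q => ?_
    rw [Derivation.sub_apply, Derivation.finset_sum_apply]
    exact sub_eq_zero.2 (hc q)
  have h2 : μ • γ.pad (x l) = ∑ s, c s • γ.pad (x (i s)) := by
    ext z
    have h3 := Derivation.congr_fun (sub_eq_zero.1 h1) z
    rw [Derivation.finset_sum_apply] at h3
    rw [LinearMap.sum_apply]
    exact h3
  refine (Submodule.smul_mem_iff_of_isUnit _ hμ).1 ?_
  rw [h2]
  exact sum_mem fun s _ => Submodule.smul_mem _ _ (Submodule.subset_span ⟨s, rfl⟩)

section Generated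

variable (γ : PoissonStructure K B) {d : ℕ} {y : Fin d → B}
  (hy : ∀ b, γ.pad b ∈ Submodule.span B (Set.range fun s => γ.pad (y s)))
include hy

/-- By Jacobi the commutator is the Hamiltonian derivation of `{y_s, y_t}`, which `hy` expands. -/
theorem exists_commutator_eq_sum (s t : Fin d) : ∃ c : Fin d → B,
    ((γ.ham (y s) : B →ₗ[K] B) : Module.End K B) * (γ.ham (y t) : B →ₗ[K] B) -
      ((γ.ham (y t) : B →ₗ[K] B) : Module.End K B) * (γ.ham (y s) : B →ₗ[K] B) =
      ∑ v, c v • ((γ.ham (y v) : B →ₗ[K] B) : Module.End K B) := by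
  obtain ⟨c, hc⟩ := (Submodule.mem_span_range_iff_exists_fun B).1 (hy (γ.pad (y s) (y t)))
  exact ⟨c, (γ.pad_pad (y s) (y t)).trans hc.symm⟩

theorem mem_span_derivWord_of_mem_diffOp {P : Module.End K B} (hP : P ∈ γ.diffOp) :
    P ∈ Submodule.span B (Set.range (derivWord fun s => γ.ham (y s))) := by
  refine γ.diffOp_le_span_derivWord _ (fun b => Submodule.span_le.2 ?_ (hy b)) hP
  rintro _ ⟨s, rfl⟩
  exact derivation_mem_span_derivWord (fun s => γ.ham (y s)) s

theorem span_padMonomial_eq_diffOp :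
    (Submodule.span B (Set.range (γ.padMonomial y)) : Set (Module.End K B)) = γ.diffOp := by
  have h : γ.padMonomial y = fun α => derivWord (fun s => γ.ham (y s)) (canonWord α) :=
    funext fun α => γ.padMonomial_eq y α
  rw [h]
  ext P
  refine ⟨fun hP => ?_, fun hP => span_derivWord_le_span_canonWord
    (γ.exists_commutator_eq_sum hy) (γ.mem_span_derivWord_of_mem_diffOp hy hP)⟩
  induction hP using Submodule.span_induction with
  | mem P hP => obtain ⟨α, rfl⟩ := hP; exact γ.derivWord_mem_diffOp y _
  | zero => exact zero_mem _
  | add P Q _ _ hP hQ => exact add_mem hP hQ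
  | smul b P _ hP => exact γ.smul_mem_diffOp b hP

/-- The growth of the algebra of Poisson differential operators is at most the transcendence
degree plus the number of Hamiltonian derivations needed. -/
theorem gkDim_diffOp_le [IsDomain B] {n : ℕ} {x : Fin n → B} (hx : IsEssentiallyGenerated K x)
    {t : ℕ} (ht : ∀ (s : ℕ) (z : Fin s → B), AlgebraicIndependent K z → s ≤ t) :
    gkDim K γ.diffOp ≤ ((t + d : ℕ) : EReal) := by
  classical
  refine gkDim_le_of_finrank_pow_le (K := K) (R := γ.diffOp) (t + d) fun V hV _ => ?_
  obtain ⟨S, rfl⟩ := hV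
  -- The coefficients of the generators are collected first, because the filtration is then built to
  -- contain them.
  choose E hE using fun P : γ.diffOp => exists_finset_forall_mem_wordFiltration
    (fun s => γ.ham (y s)) (γ.mem_span_derivWord_of_mem_diffOp hy P.2)
  obtain ⟨W, N, hW, h1, hN, hEW, H⟩ := hx.exists_isAdaptedFiltration (fun s => γ.ham (y s))
    (γ.exists_commutator_eq_sum hy) (S.biUnion E)
  have hk : ∀ P : S, ∃ k, ((P : γ.diffOp) : Module.End K B) ∈
      wordFiltration (fun s => γ.ham (y s)) (fun k => W ^ k) N k k := fun P =>
    hE P _ N H fun e he => hEW e (Finset.mem_biUnion.2 ⟨P, P.2, he⟩)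
  choose k hk using hk
  obtain ⟨κ, hκ⟩ : ∃ κ, κ = Finset.univ.sup k := ⟨_, rfl⟩
  have hV : (Submodule.span K (S : Set γ.diffOp)).map γ.diffOp.val.toLinearMap ≤
      wordFiltration (fun s => γ.ham (y s)) (fun k => W ^ k) N κ κ := by
    rw [Submodule.map_span_le]
    intro P hP
    have h2 : k ⟨P, hP⟩ ≤ κ := hκ ▸ Finset.le_sup (Finset.mem_univ _)
    exact wordFiltration_mono h2 h2 (hk ⟨P, hP⟩)
  obtain ⟨c, a, hca⟩ := exists_finrank_pow_le_of_algebraicIndependent_le ht hW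
  refine ⟨c * ((κ + 1) ^ d * (a * κ + a) ^ t), 1, fun q => ?_⟩
  have hfin : Module.Finite K ↥(W ^ (q * κ)) := Module.Finite.iff_fg.2 (hW.pow _)
  have h3 := H.finrank_le_of_le_wordFiltration hN _ _ (H.pow_le_wordFiltration hV q)
  have h4 : (Submodule.span K (S : Set γ.diffOp)).map γ.diffOp.val.toLinearMap ^ q =
      (Submodule.span K (S : Set γ.diffOp) ^ q).map γ.diffOp.val.toLinearMap :=
    (Submodule.map_pow _ γ.diffOp.val q).symm
  have h5 : Function.Injective γ.diffOp.val.toLinearMap := Subtype.val_injective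
  rw [h4, ← (Submodule.equivMapOfInjective _ h5 _).finrank_eq] at h3
  refine h3.trans ((Nat.mul_le_mul_left _ (hca _)).trans ?_)
  have h6 : q * κ + 1 ≤ (κ + 1) * (q + 1) := by nlinarith
  have h7 : a * (q * κ) + a ≤ (a * κ + a) * (q + 1) := by
    have : 0 ≤ a * κ + a * q := by positivity
    nlinarith
  calc (q * κ + 1) ^ d * (c * (a * (q * κ) + a) ^ t)
      ≤ ((κ + 1) * (q + 1)) ^ d * (c * ((a * κ + a) * (q + 1)) ^ t) := by gcongr
    _ = c * ((κ + 1) ^ d * (a * κ + a) ^ t) * (q + 1) ^ (t + d) := by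
      rw [mul_pow, mul_pow, pow_add]; ring

end Generated

end PoissonStructure

/-! ### The lower bound on growth. -/

theorem Submodule.list_prod_mem_pow {K R : Type*} [Field K] [Ring R] [Algebra K R]
    {V : Submodule K R} {k : ℕ} (l : List R) (h : ∀ a ∈ l, a ∈ V ^ k) :
    l.prod ∈ V ^ (l.length * k) := by
  induction l with
  | nil => simpa using Submodule.one_le.1 (le_refl (1 : Submodule K R))
  | cons a l ih =>
    rw [List.prod_cons, List.length_cons, Nat.succ_mul, add_comm, pow_add]
    exact Submodule.mul_mem_mul (h a List.mem_cons_self)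
      (ih fun b hb => h b (List.mem_cons_of_mem _ hb))

theorem AlgebraicIndependent.linearIndependent_prod_pow {K A : Type*} [Field K] [CommRing A]
    [Algebra K A] {t : ℕ} {y : Fin t → A} (hy : AlgebraicIndependent K y) :
    LinearIndependent K fun a : Fin t → ℕ => ∏ i, y i ^ a i := by
  have h1 : LinearIndependent K fun a : Fin t → ℕ =>
      (MvPolynomial.monomial (Finsupp.equivFunOnFinite.symm a) (1 : K)) :=
    (MvPolynomial.basisMonomials (Fin t) K).linearIndependent.comp _
      Finsupp.equivFunOnFinite.symm.injective
  have h2 := h1.map' (MvPolynomial.aeval y).toLinearMap (LinearMap.ker_eq_bot.2 hy)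
  have h3 : (fun a : Fin t → ℕ => ∏ i, y i ^ a i) = (MvPolynomial.aeval y).toLinearMap ∘
      fun a : Fin t → ℕ => MvPolynomial.monomial (Finsupp.equivFunOnFinite.symm a) (1 : K) := by
    funext a
    simp [MvPolynomial.aeval_monomial, Finsupp.prod_fintype]
  rw [h3]
  exact h2

namespace PoissonStructure

section Powers

variable {K : Type u} {A : Type v} [Field K] [CommRing A] [Algebra K A]
  (β : PoissonStructure K A)

/-- Multiplication operators, as a homomorphism of algebras. -/
def mulOpHom : A →ₐ[K] β.diffOp where
  toFun := β.mulOp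
  map_one' := Subtype.ext (by ext; simp [mulOp])
  map_mul' a b := Subtype.ext (by ext; simp [mulOp])
  map_zero' := Subtype.ext (by ext; simp [mulOp])
  map_add' a b := Subtype.ext (by ext; simp [mulOp, add_mul])
  commutes' c := Subtype.ext (by ext; simp [mulOp, Algebra.smul_def])

@[simp] theorem coe_mulOp (a : A) : (β.mulOp a : Module.End K A) = LinearMap.mulLeft K a := rfl

theorem mulOp_pow (a : A) (k : ℕ) : β.mulOp a ^ k = β.mulOp (a ^ k) :=
  (map_pow β.mulOpHom a k).symm

/-- The growth of the algebra of Poisson differential operators is at least the number of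
algebraically independent functions plus the rank of the bracket. -/
theorem le_gkDim_diffOp [CharZero K] [IsDomain A] {t d : ℕ} {y : Fin t → A}
    (hy : AlgebraicIndependent K y) (z x : Fin d → A)
    (hM : (Matrix.of fun s t => β.pad (z s) (x t)).det ≠ 0) :
    ((t + d : ℕ) : EReal) ≤ gkDim K β.diffOp := by
  let D : Fin d → β.diffOp := fun s => ⟨β.pad (z s), β.pad_mem_diffOp _⟩
  let G : Set β.diffOp := insert 1 (Set.range (fun i => β.mulOp (y i)) ∪ Set.range D)
  have hG : G.Finite := ((Set.finite_range _).union (Set.finite_range _)).insert 1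
  let V : Submodule K β.diffOp := Submodule.span K G
  have h1 : 1 ∈ V := Submodule.subset_span (Or.inl rfl)
  have hmono := Submodule.pow_mono_of_one_mem (B := β.diffOp) (W := V) h1
  -- A product of `t + d` powers with exponents at most `k` lies in `V ^ ((t + d) * k)`; the extra
  -- `1` keeps the multiplier positive when `t = d = 0`.
  refine le_gkDim_of_le_finrank_pow (K := K) (R := β.diffOp) (t + d) (V := V)
    (Submodule.fg_span hG) h1 (m := t + d + 1) (by omega) fun k => ?_
  let Y : (Fin t → Fin (k + 1)) → β.diffOp := fun a =>
    (List.ofFn fun i => β.mulOp (y i) ^ (a i : ℕ)).prod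
  let Z : (Fin d → Fin (k + 1)) → β.diffOp := fun b => (List.ofFn fun s => D s ^ (b s : ℕ)).prod
  have hpow : ∀ {g : β.diffOp} (j : Fin (k + 1)), g ∈ G → g ^ (j : ℕ) ∈ V ^ k := fun j hg =>
    hmono (Nat.le_of_lt_succ j.2) (Submodule.pow_mem_pow _ (Submodule.subset_span hg) _)
  have hY : ∀ a, Y a ∈ V ^ (t * k) := by
    intro a
    have := Submodule.list_prod_mem_pow (V := V) (k := k)
      (List.ofFn fun i => β.mulOp (y i) ^ (a i : ℕ)) (by
        intro g hg
        obtain ⟨i, rfl⟩ := (List.mem_ofFn' _ _).1 hg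
        exact hpow _ (Or.inr (Or.inl ⟨i, rfl⟩)))
    rwa [List.length_ofFn] at this
  have hZ : ∀ b, Z b ∈ V ^ (d * k) := by
    intro b
    have := Submodule.list_prod_mem_pow (V := V) (k := k)
      (List.ofFn fun s => D s ^ (b s : ℕ)) (by
        intro g hg
        obtain ⟨i, rfl⟩ := (List.mem_ofFn' _ _).1 hg
        exact hpow _ (Or.inr (Or.inr ⟨i, rfl⟩)))
    rwa [List.length_ofFn] at this
  have hYc : ∀ a, (Y a : Module.End K A) = LinearMap.mulLeft K (∏ i, y i ^ (a i : ℕ)) := by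
    intro a
    have : Y a = β.mulOpHom (∏ i, y i ^ (a i : ℕ)) := by
      rw [← List.prod_ofFn, map_list_prod, List.map_ofFn]
      simp only [Y, Function.comp_def, map_pow]
      rfl
    rw [this]; rfl
  have hZc : ∀ b, (Z b : Module.End K A) = β.padMonomial z fun s => (b s : ℕ) := by
    intro b
    have : β.diffOp.val (Z b) = β.padMonomial z fun s => (b s : ℕ) := by
      simp only [Z]
      rw [map_list_prod, List.map_ofFn]
      simp only [Function.comp_def, map_pow]
      rfl
    exact this
  have hlin : LinearIndependent K fun p : (Fin t → Fin (k + 1)) × (Fin d → Fin (k + 1)) =>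
      Y p.1 * Z p.2 := by
    have h2 := (hy.linearIndependent_prod_pow.comp (fun (a : Fin t → Fin (k + 1)) i => (a i : ℕ))
      (fun a a' h => funext fun i => Fin.ext (congrFun h i)))
    have h3 := ((β.linearIndependent_padMonomial z x hM).comp
      (fun (a : Fin d → Fin (k + 1)) i => (a i : ℕ))
      (fun a a' h => funext fun i => Fin.ext (congrFun h i)))
    -- Functions independent over `K` times operators independent over `A` give a family independent
    -- over `K`.
    have h4 := linearIndependent_smul h2 h3
    refine LinearIndependent.of_comp β.diffOp.val.toLinearMap ?_
    have hfun : (β.diffOp.val.toLinearMap ∘ fun p => Y p.1 * Z p.2) =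
        fun p : (Fin t → Fin (k + 1)) × (Fin d → Fin (k + 1)) =>
          (∏ i, y i ^ (p.1 i : ℕ)) • β.padMonomial z fun s => (p.2 s : ℕ) := by
      funext p
      simp only [Function.comp_apply, AlgHom.toLinearMap_apply, map_mul, Subalgebra.coe_val]
      rw [hYc, hZc, smul_eq_mulLeft_mul]
    rw [hfun]
    exact h4
  have hle : Submodule.span K (Set.range fun p : (Fin t → Fin (k + 1)) × (Fin d → Fin (k + 1)) =>
      Y p.1 * Z p.2) ≤ V ^ ((t + d + 1) * k) := by
    refine Submodule.span_le.2 ?_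
    rintro _ ⟨p, rfl⟩
    refine hmono (show t * k + d * k ≤ (t + d + 1) * k by nlinarith) ?_
    simp only
    rw [pow_add]
    exact Submodule.mul_mem_mul (hY _) (hZ _)
  have : Module.Finite K ↥(V ^ ((t + d + 1) * k)) :=
    Module.Finite.iff_fg.2 ((Submodule.fg_span hG).pow _)
  have h5 := Submodule.finrank_mono hle
  rw [finrank_span_eq_card hlin] at h5
  simpa [pow_add] using h5

/-! ### The Ore conditions. -/

variable {β}

/-- Modulo operators of the form `Q ∘ y`, the `m`-fold commutator of `P` is `(-y)^m P`; it vanishes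
for large `m`. -/
theorem exists_pow_smul_eq_mul_mulLeft {P : Module.End K A} (hP : P ∈ β.diffOp) (y : A) :
    ∃ m, ∃ Q ∈ β.diffOp, y ^ m • P = Q * LinearMap.mulLeft K y := by
  have key : ∀ m, ∃ Q ∈ β.diffOp,
      (commMul K y)^[m] P = (-y) ^ m • P + Q * LinearMap.mulLeft K y := by
    intro m
    induction m with
    | zero => exact ⟨0, zero_mem _, by simp⟩
    | succ m ih =>
      obtain ⟨Q, hQ, h⟩ := ih
      refine ⟨(-y) ^ m • P + (Q * LinearMap.mulLeft K y - y • Q), add_mem (β.smul_mem_diffOp _ hP)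
        (sub_mem (mul_mem hQ (β.mulLeft_mem_diffOp y)) (β.smul_mem_diffOp _ hQ)), ?_⟩
      rw [Function.iterate_succ_apply', h, commMul_apply]
      ext z
      simp only [LinearMap.sub_apply, LinearMap.add_apply, Module.End.mul_apply,
        LinearMap.smul_apply, LinearMap.mulLeft_apply, smul_eq_mul]
      ring
  obtain ⟨m, hm⟩ := exists_commMul_iterate_eq_zero β.ham y (β.mem_span_derivWord_ham hP)
  obtain ⟨Q, hQ, h⟩ := key m
  rw [hm m le_rfl] at h
  refine ⟨m, ((-1) ^ m * -1 : A) • Q, β.smul_mem_diffOp _ hQ, ?_⟩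
  have h2 : y ^ m • P = ((-1 : A) ^ m) • (-y) ^ m • P := by
    rw [smul_smul, ← mul_pow, neg_one_mul, neg_neg]
  rw [h2, eq_neg_of_add_eq_zero_left h.symm, mul_smul, neg_one_smul]
  ext z
  simp

/-- The mirror argument: modulo operators of the form `y ∘ Q`, the `m`-fold commutator is `P ∘ y^m`.
-/
theorem exists_mul_mulLeft_pow_eq_smul {P : Module.End K A} (hP : P ∈ β.diffOp) (y : A) :
    ∃ m, ∃ Q ∈ β.diffOp, P * LinearMap.mulLeft K (y ^ m) = y • Q := by
  have key : ∀ m, ∃ Q ∈ β.diffOp,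
      (commMul K y)^[m] P = P * LinearMap.mulLeft K (y ^ m) + y • Q := by
    intro m
    induction m with
    | zero => exact ⟨0, zero_mem _, by ext; simp⟩
    | succ m ih =>
      obtain ⟨Q, hQ, h⟩ := ih
      refine ⟨Q * LinearMap.mulLeft K y - y • Q - P * LinearMap.mulLeft K (y ^ m),
        sub_mem (sub_mem (mul_mem hQ (β.mulLeft_mem_diffOp y)) (β.smul_mem_diffOp _ hQ))
          (mul_mem hP (β.mulLeft_mem_diffOp _)), ?_⟩
      rw [Function.iterate_succ_apply', h, commMul_apply]
      ext z
      simp only [LinearMap.sub_apply, LinearMap.add_apply, Module.End.mul_apply,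
        LinearMap.smul_apply, LinearMap.mulLeft_apply, smul_eq_mul]
      rw [pow_succ, mul_assoc]
      ring
  obtain ⟨m, hm⟩ := exists_commMul_iterate_eq_zero β.ham y (β.mem_span_derivWord_ham hP)
  obtain ⟨Q, hQ, h⟩ := key m
  rw [hm m le_rfl] at h
  refine ⟨m, -Q, neg_mem hQ, ?_⟩
  rw [eq_neg_of_add_eq_zero_left h.symm, smul_neg]

/-- If `P ∘ y = 0`, the `m`-fold commutator is exactly `(-y)^m P`, so nilpotence and the absence of
zero divisors give `P = 0`. -/
theorem eq_zero_of_mul_mulLeft_eq_zero [IsDomain A] {P : Module.End K A} (hP : P ∈ β.diffOp)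
    {y : A} (hy : y ≠ 0) (h : P * LinearMap.mulLeft K y = 0) : P = 0 := by
  have key : ∀ m, (commMul K y)^[m] P = (-y) ^ m • P := by
    intro m
    induction m with
    | zero => simp
    | succ m ih =>
      rw [Function.iterate_succ_apply', ih, map_smul, commMul_apply, h, zero_sub, pow_succ,
        mul_smul, neg_smul]
  obtain ⟨m, hm⟩ := exists_commMul_iterate_eq_zero β.ham y (β.mem_span_derivWord_ham hP)
  have h1 := hm m le_rfl
  rw [key] at h1
  ext z
  have h2 := LinearMap.congr_fun h1 z
  rw [LinearMap.smul_apply, smul_eq_mul, LinearMap.zero_apply] at h2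
  exact (mul_eq_zero.1 h2).resolve_left (pow_ne_zero _ (neg_ne_zero.2 hy))

variable (β)

/-- The powers of a nonzero function form a left Ore set. -/
theorem nonempty_oreSet_powers [IsDomain A] {μ : A} (hμ : μ ≠ 0) :
    Nonempty (OreLocalization.OreSet (Submonoid.powers (β.mulOp μ))) := by
  rw [OreLocalization.nonempty_oreSet_iff]
  constructor
  · rintro P Q ⟨_, k, rfl⟩ h
    refine ⟨1, ?_⟩
    have h0 : P * β.mulOp (μ ^ k) = Q * β.mulOp (μ ^ k) := by rw [← mulOp_pow]; exact h
    have h1 : ((P : Module.End K A) - Q) * LinearMap.mulLeft K (μ ^ k) = 0 := by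
      rw [sub_mul]; exact sub_eq_zero.2 (congrArg Subtype.val h0)
    have h2 := eq_zero_of_mul_mulLeft_eq_zero (sub_mem P.2 Q.2) (pow_ne_zero k hμ) h1
    rw [Subtype.ext (sub_eq_zero.1 h2)]
  · rintro P ⟨_, k, rfl⟩
    obtain ⟨m, Q, hQ, h⟩ := exists_pow_smul_eq_mul_mulLeft P.2 (μ ^ k)
    refine ⟨⟨Q, hQ⟩, ⟨β.mulOp μ ^ (k * m), k * m, rfl⟩, Subtype.ext ?_⟩
    simp only [mulOp_pow, Subalgebra.coe_mul, coe_mulOp]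
    rw [← h, smul_eq_mulLeft_mul, pow_mul]

/-- The powers of a nonzero function form a right Ore set. -/
theorem nonempty_oreSet_powers_op [IsDomain A] {μ : A} (hμ : μ ≠ 0) :
    Nonempty (OreLocalization.OreSet (Submonoid.powers (β.mulOp μ)).op) := by
  rw [OreLocalization.nonempty_oreSet_iff]
  constructor
  · rintro P Q ⟨s, hs⟩ h
    obtain ⟨k, hk⟩ := hs
    refine ⟨1, ?_⟩
    have h0 : s.unop * P.unop = s.unop * Q.unop := congrArg MulOpposite.unop h
    have h1 : s.unop = β.mulOp (μ ^ k) := by rw [← mulOp_pow]; exact hk.symm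
    rw [h1] at h0
    have h2 : P.unop = Q.unop := by
      refine Subtype.ext (LinearMap.ext fun z => ?_)
      have h3 := LinearMap.congr_fun (congrArg Subtype.val h0) z
      exact mul_left_cancel₀ (pow_ne_zero k hμ) h3
    rw [MulOpposite.unop_injective h2]
  · rintro P ⟨s, hs⟩
    obtain ⟨k, hk⟩ := hs
    obtain ⟨m, Q, hQ, h⟩ := exists_mul_mulLeft_pow_eq_smul P.unop.2 (μ ^ k)
    refine ⟨MulOpposite.op ⟨Q, hQ⟩, ⟨MulOpposite.op (β.mulOp μ ^ (k * m)), k * m, rfl⟩,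
      MulOpposite.unop_injective (Subtype.ext ?_)⟩
    have h1 : s.unop = β.mulOp (μ ^ k) := by rw [← mulOp_pow]; exact hk.symm
    simp only [MulOpposite.unop_mul, MulOpposite.unop_op, h1, mulOp_pow, Subalgebra.coe_mul,
      coe_mulOp]
    rw [pow_mul, h, smul_eq_mulLeft_mul]

end Powers

/-! ### Operators on a localization. -/

section Localization

variable {K : Type u} {A : Type v} [Field K] [CommRing A] [Algebra K A] {B : Type*}
  [CommRing B] [Algebra K B] [Algebra A B] [IsScalarTower K A B]
  {β : PoissonStructure K A} {γ : PoissonStructure K B}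

omit [Algebra K A] [IsScalarTower K A B] in
/-- Operators on a localization are determined by their values on the original algebra. -/
theorem eq_zero_of_forall_algebraMap_eq_zero (S : Submonoid A) [IsLocalization S B]
    {P : Module.End K B} (hP : P ∈ γ.diffOp) (h : ∀ a, P (algebraMap A B a) = 0) : P = 0 := by
  ext b
  obtain ⟨⟨a, s⟩, hb⟩ := IsLocalization.surj S b
  simp only at hb
  set y : B := algebraMap A B s with hy
  have hyu : IsUnit y := IsLocalization.map_units B s
  have hvan : ∀ m a, (commMul K y)^[m] P (algebraMap A B a) = 0 := by
    intro m
    induction m with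
    | zero => exact h
    | succ m ih =>
      intro a
      rw [Function.iterate_succ_apply', commMul_apply]
      simp only [LinearMap.sub_apply, Module.End.mul_apply, LinearMap.mulLeft_apply,
        LinearMap.smul_apply, ih, smul_zero, sub_zero]
      rw [hy, ← map_mul, ih]
  obtain ⟨m, hm⟩ := exists_commMul_iterate_eq_zero γ.ham y (γ.mem_span_derivWord_ham hP)
  -- Descent from the vanishing `m`-fold commutator: as `y b` comes from `A`, where all commutators
  -- vanish, the next commutator at `b` is `-y` times the previous one, and `y` is a unit.
  have key : ∀ j, j ≤ m → (commMul K y)^[m - j] P b = 0 := by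
    intro j
    induction j with
    | zero => intro _; rw [Nat.sub_zero, hm m le_rfl]; rfl
    | succ j ih =>
      intro hj
      have h1 := ih (by omega)
      rw [show m - j = (m - (j + 1)) + 1 by omega, Function.iterate_succ_apply', commMul_apply]
        at h1
      simp only [LinearMap.sub_apply, Module.End.mul_apply, LinearMap.mulLeft_apply,
        LinearMap.smul_apply, smul_eq_mul] at h1
      rw [mul_comm y b, hb, hvan, zero_sub, neg_eq_zero] at h1
      exact (hyu.mul_right_eq_zero).1 h1
  simpa using key m le_rfl

theorem exists_extension_of_mem_diffOp (hβγ : β.Extends γ) {P : Module.End K A}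
    (hP : P ∈ β.diffOp) :
    ∃ Q ∈ γ.diffOp, ∀ a, Q (algebraMap A B a) = algebraMap A B (P a) := by
  induction hP using Algebra.adjoin_induction with
  | mem P h =>
    rcases h with ⟨a, rfl⟩ | ⟨a, rfl⟩
    · exact ⟨_, γ.mulLeft_mem_diffOp (algebraMap A B a), fun c => by simp⟩
    · exact ⟨_, γ.pad_mem_diffOp (algebraMap A B a), hβγ a⟩
  | algebraMap c =>
    refine ⟨_, Subalgebra.algebraMap_mem _ c, fun a => ?_⟩
    simp [algebraMap.coe_smul]
  | add P P' _ _ h h' =>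
    obtain ⟨Q, hQ, h⟩ := h
    obtain ⟨Q', hQ', h'⟩ := h'
    exact ⟨Q + Q', add_mem hQ hQ', fun a => by simp [h, h']⟩
  | mul P P' _ _ h h' =>
    obtain ⟨Q, hQ, h⟩ := h
    obtain ⟨Q', hQ', h'⟩ := h'
    exact ⟨Q * Q', mul_mem hQ hQ', fun a => by simp [h, h']⟩

/-- The action of the operators extends to a localization. -/
theorem exists_algHom_diffOp (S : Submonoid A) [IsLocalization S B] (hβγ : β.Extends γ) :
    ∃ φ : β.diffOp →ₐ[K] γ.diffOp, ∀ (P : β.diffOp) (a : A),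
      (φ P).1 (algebraMap A B a) = algebraMap A B (P.1 a) := by
  choose F hF hF' using fun P : β.diffOp => exists_extension_of_mem_diffOp hβγ P.2
  -- Extensions are unique, so the chosen ones are compatible with sums and products.
  have uniq : ∀ Q Q' : γ.diffOp, (∀ a, Q.1 (algebraMap A B a) = Q'.1 (algebraMap A B a)) →
      Q = Q' := by
    intro Q Q' h
    have := eq_zero_of_forall_algebraMap_eq_zero S (Q - Q').2 fun a => by
      change Q.1 (algebraMap A B a) - Q'.1 (algebraMap A B a) = 0
      rw [h, sub_self]
    exact sub_eq_zero.1 (Subtype.ext this)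
  exact ⟨
    { toFun := fun P => ⟨F P, hF P⟩
      map_one' := uniq _ _ fun a => by simp [hF']
      map_mul' := fun P Q => uniq _ _ fun a => by simp [hF']
      map_zero' := uniq _ _ fun a => by simp [hF']
      map_add' := fun P Q => uniq _ _ fun a => by simp [hF']
      commutes' := fun c => uniq _ _ fun a => by simp [hF', algebraMap.coe_smul] }, hF'⟩

omit [IsScalarTower K A B] in
theorem injective_of_forall_algebraMap (hAB : Function.Injective (algebraMap A B))
    {φ : β.diffOp →ₐ[K] γ.diffOp} (hφ : ∀ (P : β.diffOp) (a : A),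
      (φ P).1 (algebraMap A B a) = algebraMap A B (P.1 a)) : Function.Injective φ := by
  rw [injective_iff_map_eq_zero]
  intro P hP
  refine Subtype.ext (LinearMap.ext fun a => hAB ?_)
  rw [← hφ, hP]
  simp

/-- Localizing the algebra of operators gives the operators on the localization. -/
theorem exists_oreLocalization_algEquiv {μ : A} [IsLocalization.Away μ B]
    (hAB : Function.Injective (algebraMap A B)) (hβγ : β.Extends γ) {d : ℕ} {y : Fin d → A}
    (hy : ∀ b, γ.pad b ∈ Submodule.span B (Set.range fun s => γ.pad (algebraMap A B (y s))))
    [OreLocalization.OreSet (Submonoid.powers (β.mulOp μ))] :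
    ∃ e : OreLocalization (Submonoid.powers (β.mulOp μ)) β.diffOp ≃ₐ[K] γ.diffOp,
      ∀ (P : β.diffOp) (a : A), (e (OreLocalization.numeratorRingHom P)).1 (algebraMap A B a) =
        algebraMap A B (P.1 a) := by
  obtain ⟨φ, hφ⟩ := exists_algHom_diffOp (Submonoid.powers μ) hβγ
  have hinj := injective_of_forall_algebraMap hAB hφ
  have uniq : ∀ Q Q' : γ.diffOp, (∀ a, Q.1 (algebraMap A B a) = Q'.1 (algebraMap A B a)) →
      Q = Q' := by
    intro Q Q' h
    have := eq_zero_of_forall_algebraMap_eq_zero (Submonoid.powers μ) (Q - Q').2 fun a => by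
      change Q.1 (algebraMap A B a) - Q'.1 (algebraMap A B a) = 0
      rw [h, sub_self]
    exact sub_eq_zero.1 (Subtype.ext this)
  have hφmul : ∀ a, φ (β.mulOp a) = γ.mulOp (algebraMap A B a) := fun a =>
    uniq _ _ fun c => by rw [hφ]; simp
  have hφpad : ∀ a, φ ⟨β.pad a, β.pad_mem_diffOp a⟩ =
      ⟨γ.pad (algebraMap A B a), γ.pad_mem_diffOp _⟩ := fun a =>
    uniq _ _ fun c => by rw [hφ]; exact (hβγ a c).symm
  have hunit : ∀ s : Submonoid.powers (β.mulOp μ), IsUnit (φ s) := by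
    rintro ⟨_, k, rfl⟩
    simp only [map_pow, hφmul]
    exact ((IsLocalization.Away.algebraMap_isUnit (S := B) μ).map γ.mulOpHom).pow k
  let fS : Submonoid.powers (β.mulOp μ) →* γ.diffOpˣ :=
    IsUnit.liftRight (((φ : β.diffOp →* γ.diffOp)).comp (Submonoid.subtype _)) hunit
  have hfS : ∀ s : Submonoid.powers (β.mulOp μ), (φ : β.diffOp →+* γ.diffOp) s = fS s := fun s => rfl
  let Ψ := OreLocalization.universalHom (φ : β.diffOp →+* γ.diffOp) fS hfS
  have hΨ : ∀ P, Ψ (OreLocalization.numeratorRingHom P) = φ P := fun P =>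
    OreLocalization.universalHom_commutes _ _ hfS
  have hΨdiv : ∀ P s, Ψ (OreLocalization.oreDiv P s) = ((fS s)⁻¹ : γ.diffOpˣ) * φ P := fun P s =>
    OreLocalization.universalHom_apply _ _ hfS
  let Ψ' : OreLocalization (Submonoid.powers (β.mulOp μ)) β.diffOp →ₐ[K] γ.diffOp :=
    { Ψ with commutes' := fun c => (hΨ (algebraMap K β.diffOp c)).trans (φ.commutes c) }
  have hΨinj : Function.Injective Ψ' := by
    intro z z' hzz'
    induction z using OreLocalization.ind with
    | c P s =>
    induction z' using OreLocalization.ind with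
    | c P' s' =>
    have h1 : ((fS s)⁻¹ : γ.diffOpˣ) * φ P = ((fS s')⁻¹ : γ.diffOpˣ) * φ P' :=
      (hΨdiv P s).symm.trans (hzz'.trans (hΨdiv P' s'))
    rw [Units.inv_mul_eq_iff_eq_mul, ← hfS] at h1
    obtain ⟨v, u, huv⟩ := OreLocalization.oreCondition (s' : β.diffOp) s
    refine OreLocalization.oreDiv_eq_iff.2 ⟨u, v, hinj ?_, huv⟩
    have h2 : φ P' = φ s' * (((fS s')⁻¹ : γ.diffOpˣ) * φ P') := by
      have h3 : φ s' = fS s' := hfS s'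
      rw [h3, ← mul_assoc, Units.mul_inv, one_mul]
    have h4 : φ u * φ s' = φ v * φ s := by rw [← map_mul, huv, map_mul]
    rw [Submonoid.smul_def, smul_eq_mul, smul_eq_mul, map_mul, map_mul, h1, h2, ← mul_assoc, h4,
      ← mul_assoc]
    have h5 : (φ : β.diffOp →+* γ.diffOp) s = φ s := rfl
    rw [h5, ← mul_assoc, ← h2, mul_assoc, mul_assoc]
  have hsurj : Function.Surjective Ψ' := by
    -- Coefficients stand on the left of words in the `pad (y s)`, so a power of `μ` clears all
    -- denominators.
    have claim : ∀ Q ∈ Submodule.span B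
        (Set.range (derivWord fun s => γ.ham (algebraMap A B (y s)))),
        ∃ (k : ℕ) (P : β.diffOp), algebraMap A B (μ ^ k) • Q = (φ P).1 := by
      intro Q hQ
      induction hQ using Submodule.span_induction with
      | mem Q h =>
        obtain ⟨l, rfl⟩ := h
        refine ⟨0, ⟨derivWord (fun s => β.ham (y s)) l, β.derivWord_mem_diffOp y l⟩, ?_⟩
        rw [pow_zero, map_one, one_smul]
        induction l with
        | nil => exact (congrArg Subtype.val (map_one φ)).symm
        | cons s l ih =>
          rw [derivWord_cons, ih]
          have h1 : (⟨derivWord (fun s => β.ham (y s)) (s :: l), β.derivWord_mem_diffOp y _⟩ :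
              β.diffOp) = ⟨β.pad (y s), β.pad_mem_diffOp _⟩ *
                ⟨derivWord (fun s => β.ham (y s)) l, β.derivWord_mem_diffOp y l⟩ :=
            Subtype.ext ((derivWord_cons (fun s => β.ham (y s)) s l).trans rfl)
          rw [h1, map_mul, hφpad]
          rfl
      | zero => exact ⟨0, 0, by simp⟩
      | add Q Q' _ _ h h' =>
        obtain ⟨k, P, h⟩ := h
        obtain ⟨k', P', h'⟩ := h'
        refine ⟨k + k', β.mulOp (μ ^ k') * P + β.mulOp (μ ^ k) * P', ?_⟩
        rw [map_add, map_mul, map_mul, hφmul, hφmul, Subalgebra.coe_add, Subalgebra.coe_mul,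
          Subalgebra.coe_mul, ← h, ← h', coe_mulOp, coe_mulOp, ← smul_eq_mulLeft_mul,
          ← smul_eq_mulLeft_mul, smul_smul, smul_smul, smul_add, pow_add, map_mul,
          mul_comm (algebraMap A B (μ ^ k'))]
      | smul b Q _ h =>
        obtain ⟨k, P, h⟩ := h
        obtain ⟨⟨a, ⟨_, j, rfl⟩⟩, hb⟩ := IsLocalization.surj (Submonoid.powers μ) b
        simp only at hb
        refine ⟨j + k, β.mulOp a * P, ?_⟩
        rw [map_mul, hφmul, Subalgebra.coe_mul, ← h, coe_mulOp, ← smul_eq_mulLeft_mul, ← hb,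
          smul_smul, smul_smul, pow_add, map_mul]
        congr 1
        ring
    intro Q
    obtain ⟨k, P, hk⟩ := claim Q.1 (γ.mem_span_derivWord_of_mem_diffOp hy Q.2)
    refine ⟨OreLocalization.oreDiv P ⟨β.mulOp μ ^ k, k, rfl⟩, ?_⟩
    refine (hΨdiv _ _).trans ?_
    rw [Units.inv_mul_eq_iff_eq_mul, ← hfS]
    refine Subtype.ext ?_
    simp only [RingHom.coe_coe, mulOp_pow, hφmul, Subalgebra.coe_mul, coe_mulOp]
    rw [← hk, smul_eq_mulLeft_mul]
  exact ⟨AlgEquiv.ofBijective Ψ' ⟨hΨinj, hsurj⟩, fun P a =>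
    (congrArg (fun Q : γ.diffOp => Q.1 (algebraMap A B a)) (hΨ P)).trans (hφ P a)⟩

end Localization

end PoissonStructure

/-! ### Growth of the function algebra, and minors of the bracket matrix. -/

/-- The number of algebraically independent elements bounds the growth from below. -/
theorem le_gkDim_of_algebraicIndependent {K A : Type*} [Field K] [CommRing A] [Algebra K A]
    {t : ℕ} {y : Fin t → A} (hy : AlgebraicIndependent K y) : (t : EReal) ≤ gkDim K A := by
  let G : Set A := insert 1 (Set.range y)
  have hG : G.Finite := (Set.finite_range _).insert 1
  let V : Submodule K A := Submodule.span K G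
  have h1 : 1 ∈ V := Submodule.subset_span (Or.inl rfl)
  have hmono := Submodule.pow_mono_of_one_mem (B := A) (W := V) h1
  refine le_gkDim_of_le_finrank_pow (K := K) (R := A) t (V := V)
    (Submodule.fg_span hG) h1 (m := t + 1) (by omega) fun k => ?_
  have hlin := (hy.linearIndependent_prod_pow.comp (fun (a : Fin t → Fin (k + 1)) i => (a i : ℕ))
    (fun a a' h => funext fun i => Fin.ext (congrFun h i)))
  have hle : Submodule.span K (Set.range ((fun a : Fin t → ℕ => ∏ i, y i ^ a i) ∘
      fun (a : Fin t → Fin (k + 1)) i => (a i : ℕ))) ≤ V ^ ((t + 1) * k) := by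
    refine Submodule.span_le.2 ?_
    rintro _ ⟨a, rfl⟩
    have := Submodule.list_prod_mem_pow (V := V) (k := k) (List.ofFn fun i => y i ^ (a i : ℕ)) (by
      intro g hg
      obtain ⟨i, rfl⟩ := (List.mem_ofFn' _ _).1 hg
      have hyV : y i ∈ V := Submodule.subset_span (Or.inr ⟨i, rfl⟩)
      exact hmono (Nat.le_of_lt_succ (a i).2) (Submodule.pow_mem_pow _ hyV _))
    rw [List.length_ofFn, List.prod_ofFn] at this
    exact hmono (Nat.mul_le_mul_right k (Nat.le_succ t)) this
  have : Module.Finite K ↥(V ^ ((t + 1) * k)) :=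
    Module.Finite.iff_fg.2 ((Submodule.fg_span hG).pow _)
  have h5 := Submodule.finrank_mono hle
  rw [finrank_span_eq_card hlin] at h5
  simpa using h5

theorem Matrix.exists_linearIndependent_rows {F : Type*} [Field F] {m n d : ℕ}
    (M : Matrix (Fin m) (Fin n) F) (hM : M.rank = d) :
    ∃ i : Fin d → Fin m, LinearIndependent F (M.submatrix i id).row := by
  rw [M.rank_eq_finrank_span_row] at hM
  subst hM
  obtain ⟨g, hg, -, hlin⟩ := Submodule.exists_fun_fin_finrank_span_eq F (Set.range M.row)
  choose i hi using hg
  refine ⟨i, ?_⟩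
  rwa [← funext hi] at hlin

/-- A matrix of rank `d` has a nonzero minor of size `d`. -/
theorem exists_det_submatrix_ne_zero_of_fracRank {A : Type*} [CommRing A] [IsDomain A] {m n d : ℕ}
    (M : Matrix (Fin m) (Fin n) A) (hM : fracRank M = d) :
    ∃ (i : Fin d → Fin m) (j : Fin d → Fin n), (M.submatrix i j).det ≠ 0 := by
  obtain ⟨i, hi⟩ := Matrix.exists_linearIndependent_rows _ hM
  -- Independent columns are chosen inside the `d` rows already selected, whose submatrix still has
  -- rank `d`.
  obtain ⟨j, hj⟩ := Matrix.exists_linearIndependent_rows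
    ((M.map (algebraMap A (FractionRing A))).submatrix i id).transpose (d := d)
    (by rw [Matrix.rank_transpose, hi.rank_matrix, Fintype.card_fin])
  refine ⟨i, j, fun h => ?_⟩
  have h1 := Matrix.linearIndependent_rows_iff_isUnit.1 hj
  rw [Matrix.isUnit_iff_isUnit_det] at h1
  refine h1.ne_zero ?_
  have h2 : (((M.map (algebraMap A (FractionRing A))).submatrix i id).transpose.submatrix j id) =
      ((M.submatrix i j).map (algebraMap A (FractionRing A))).transpose := rfl
  rw [h2, Matrix.det_transpose]
  exact ((algebraMap A (FractionRing A)).map_det _).symm.trans (by rw [h, map_zero])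

theorem IsTranscendenceBasis.le_of_injective_algHom {K L C : Type*} [Field K] [Field L]
    [Algebra K L] [CommRing C] [Algebra K C] {t : ℕ} {y : Fin t → L}
    (hy : IsTranscendenceBasis K y) (φ : C →ₐ[K] L) (hφ : Function.Injective φ) {s : ℕ}
    {z : Fin s → C} (hz : AlgebraicIndependent K z) : s ≤ t :=
  hy.le_of_algebraicIndependent (hz.map' (f := φ) hφ)

namespace PoissonStructure

/-- Skew-symmetry makes the swapped minor equal to `μ` up to sign, so the rows `j` serve as well as
the rows `i`. -/
theorem det_submatrix_bracketMatrix_swap {K : Type u} {A : Type v} [Field K] [CommRing A]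
    [Algebra K A] (β : PoissonStructure K A) {n d : ℕ} (x : Fin n → A) (i j : Fin d → Fin n) :
    ((β.bracketMatrix x).submatrix j i).det = (-1) ^ d * ((β.bracketMatrix x).submatrix i j).det := by
  have h : (β.bracketMatrix x).submatrix j i = -((β.bracketMatrix x).submatrix i j).transpose := by
    ext s t
    exact β.pad_skew _ _
  rw [h, Matrix.det_neg, Matrix.det_transpose, Fintype.card_fin]

section

variable {K : Type u} {A : Type v} [Field K] [CommRing A] [IsDomain A] [Algebra K A] {B : Type*}
  [CommRing B] [Algebra K B] [Algebra A B] [IsScalarTower K A B]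
  {β : PoissonStructure K A} {γ : PoissonStructure K B}

omit [IsScalarTower K A B] in
theorem pad_mem_span_pad_of_extends (hβγ : β.Extends γ) {n d : ℕ} {x : Fin n → A}
    (hx : IsEssentiallyGenerated K fun l => algebraMap A B (x l))
    (hd : fracRank (β.bracketMatrix x) = d) (i j : Fin d → Fin n)
    (hdet : ((β.bracketMatrix x).submatrix i j).det ≠ 0)
    (hu : IsUnit (algebraMap A B ((β.bracketMatrix x).submatrix i j).det)) (b : B) :
    γ.pad b ∈ Submodule.span B (Set.range fun s => γ.pad (algebraMap A B (x (i s)))) := by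
  refine γ.pad_mem_span_pad hx i hu (fun l => ?_) b
  obtain ⟨c, hc⟩ := exists_det_mul_eq_sum_of_fracRank _ hd i j hdet l
  refine ⟨fun s => algebraMap A B (c s), fun q => ?_⟩
  have := congrArg (algebraMap A B) (hc q)
  rw [map_mul, map_sum] at this
  simp only [map_mul] at this
  rw [hβγ]
  simp only [hβγ _ _]
  exact this

omit [IsDomain A] [IsScalarTower K A B] in
theorem det_bracket_ne_zero_of_extends (hβγ : β.Extends γ)
    (hAB : Function.Injective (algebraMap A B)) {n d : ℕ} {x : Fin n → A} (i j : Fin d → Fin n)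
    (hdet : ((β.bracketMatrix x).submatrix i j).det ≠ 0) :
    (Matrix.of fun s t => γ.pad (algebraMap A B (x (i s))) (algebraMap A B (x (j t)))).det ≠ 0 := by
  have h : (Matrix.of fun s t => γ.pad (algebraMap A B (x (i s))) (algebraMap A B (x (j t)))) =
      (algebraMap A B).mapMatrix ((β.bracketMatrix x).submatrix i j) := by
    ext s t
    exact hβγ _ _
  rw [h, ← RingHom.map_det]
  exact (map_ne_zero_iff _ hAB).2 hdet

end

end PoissonStructure

end

/-! ### The main theorem. -/

theorem proposition1p5 {K : Type*} [Field K] [CharZero K]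
    -- the domain of essentially finite type `A = S⁻¹ (K[x_1, …, x_n] / (f_1, …, f_m))`
    {n m : ℕ} (f : Fin m → MvPolynomial (Fin n) K) (hI : (Ideal.span (Set.range f)).IsPrime)
    (S : Submonoid (AffineAlg f))
    {A : Type*} [CommRing A] [IsDomain A] [Algebra K A] [Algebra (AffineAlg f) A]
    [IsScalarTower K (AffineAlg f) A] [IsLocalization S A]
    (β : PoissonStructure K A)
    (r d : ℕ) (hr : r = fracRank (jacobianMat f A))
    (hd : d = fracRank (β.bracketMatrix (coordinate f A))) :
    gkDim K β.diffOp = gkDim K A + (d : EReal) ∧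
    gkDim K A + (d : EReal) = (((n : ℝ) - (r : ℝ) + (d : ℝ) : ℝ) : EReal) ∧
    ∀ (i j : Fin d ↪o Fin n) (μ : A),
      μ = ((β.bracketMatrix (coordinate f A)).submatrix i j).det → μ ≠ 0 →
      -- the powers of `μ` form a left and right Ore set in `PD(A)`
      Nonempty (OreLocalization.OreSet (Submonoid.powers (β.mulOp μ))) ∧
      Nonempty (OreLocalization.OreSet (Submonoid.powers (β.mulOp μ)).op) ∧
      -- the Poisson structure extends uniquely to `A_μ`
      (∃! γ : PoissonStructure K (Localization.Away μ), β.Extends γ) ∧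
      ∀ γ : PoissonStructure K (Localization.Away μ), β.Extends γ →
        (∀ [OreLocalization.OreSet (Submonoid.powers (β.mulOp μ))],
          (∃ e : OreLocalization (Submonoid.powers (β.mulOp μ)) β.diffOp ≃ₐ[K] γ.diffOp,
            ∀ (P : β.diffOp) (a : A),
              (e (OreLocalization.numeratorRingHom P)).1 (algebraMap A (Localization.Away μ) a) =
                algebraMap A (Localization.Away μ) (P.1 a)) ∧
          gkDim K (OreLocalization (Submonoid.powers (β.mulOp μ)) β.diffOp) =
            gkDim K A + (d : EReal)) ∧
        -- the ordered monomials in either system form an `A_μ`-basis of `PD(A_μ)`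
        ∀ k : Fin d ↪o Fin n, k = i ∨ k = j →
          LinearIndependent (Localization.Away μ)
            (γ.padMonomial fun s => algebraMap A (Localization.Away μ) (coordinate f A (k s))) ∧
          (Submodule.span (Localization.Away μ) (Set.range
            (γ.padMonomial fun s => algebraMap A (Localization.Away μ) (coordinate f A (k s)))) :
              Set (Module.End K (Localization.Away μ))) = γ.diffOp := by
  obtain ⟨t, s, hb, hrt⟩ := exists_isTranscendenceBasis_coordinate f hI S A
  have hy : AlgebraicIndependent K fun q => coordinate f A (s q) :=
    AlgebraicIndependent.of_comp (IsScalarTower.toAlgHom K A (FractionRing A)) hb.1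
  have hA : gkDim K A = (t : EReal) := le_antisymm
    (gkDim_le_of_algebraicIndependent_le fun _ _ hz => IsTranscendenceBasis.le_of_injective_algHom
      hb (IsScalarTower.toAlgHom K A (FractionRing A)) (IsFractionRing.injective A _) hz)
    (le_gkDim_of_algebraicIndependent hy)
  have hAd : gkDim K A + (d : EReal) = ((t + d : ℕ) : EReal) := by
    rw [hA]; push_cast; rfl
  have hx := isEssentiallyGenerated_coordinate f S A
  have hinj : ∀ {μ : A}, μ ≠ 0 → Function.Injective (algebraMap A (Localization.Away μ)) :=
    fun hμ => IsLocalization.injective _ (powers_le_nonZeroDivisors_of_noZeroDivisors hμ)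
  have hdom : ∀ {μ : A}, μ ≠ 0 → IsDomain (Localization.Away μ) := fun hμ =>
    IsLocalization.isDomain_localization (powers_le_nonZeroDivisors_of_noZeroDivisors hμ)
  have hgen : ∀ {μ : A}, IsEssentiallyGenerated K fun l =>
      algebraMap A (Localization.Away μ) (coordinate f A l) := fun {μ} =>
    hx.of_isLocalization (Submonoid.powers μ)
  have het : ∀ {μ : A}, Algebra.FormallyEtale A (Localization.Away μ) := fun {μ} =>
    Algebra.FormallyEtale.of_isLocalization (Submonoid.powers μ)
  have hle : ∀ (i j : Fin d → Fin n) (μ : A),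
      μ = ((β.bracketMatrix (coordinate f A)).submatrix i j).det → μ ≠ 0 →
      ∀ γ : PoissonStructure K (Localization.Away μ), β.Extends γ →
      (∀ b, γ.pad b ∈ Submodule.span (Localization.Away μ) (Set.range fun s =>
        γ.pad (algebraMap A (Localization.Away μ) (coordinate f A (i s))))) ∧
      gkDim K γ.diffOp ≤ ((t + d : ℕ) : EReal) := by
    intro i j μ hμ h0 γ hγ
    have := hdom h0
    have hspan := PoissonStructure.pad_mem_span_pad_of_extends hγ hgen hd.symm i j (hμ ▸ h0)
      (hμ ▸ IsLocalization.Away.algebraMap_isUnit μ)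
    refine ⟨hspan, γ.gkDim_diffOp_le hspan hgen fun _ _ hz => ?_⟩
    have hu : ∀ y : Submonoid.powers μ,
        IsUnit (IsScalarTower.toAlgHom K A (FractionRing A) y) := by
      rintro ⟨_, k, rfl⟩
      rw [map_pow]
      exact (((map_ne_zero_iff _ (IsFractionRing.injective A (FractionRing A))).2 h0).isUnit).pow k
    -- `A_μ` embeds in the fraction field of `A`, so it has at most `t` independent elements.
    refine IsTranscendenceBasis.le_of_injective_algHom hb
      (IsLocalization.liftAlgHom (M := Submonoid.powers μ) (S := Localization.Away μ) hu) ?_ hz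
    rw [injective_iff_map_eq_zero]
    intro b hb0
    obtain ⟨⟨a, c⟩, hac⟩ := IsLocalization.surj (Submonoid.powers μ) b
    have h1 := congrArg (IsLocalization.liftAlgHom (M := Submonoid.powers μ)
      (S := Localization.Away μ) hu) hac
    rw [map_mul, hb0, zero_mul] at h1
    have h2 : algebraMap A (FractionRing A) a = 0 :=
      (IsLocalization.lift_eq (M := Submonoid.powers μ) hu a).symm.trans h1.symm
    rw [(map_eq_zero_iff _ (IsFractionRing.injective A (FractionRing A))).1 h2, map_zero] at hac
    exact (IsLocalization.map_units (Localization.Away μ) c).mul_left_eq_zero.1 hac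
  have hge : ∀ i j : Fin d → Fin n, ((β.bracketMatrix (coordinate f A)).submatrix i j).det ≠ 0 →
      ((t + d : ℕ) : EReal) ≤ gkDim K β.diffOp := fun i j h0 =>
    β.le_gkDim_diffOp hy (fun q => coordinate f A (i q)) (fun q => coordinate f A (j q)) h0
  have hmono : ∀ (μ : A), μ ≠ 0 → ∀ γ : PoissonStructure K (Localization.Away μ), β.Extends γ →
      gkDim K β.diffOp ≤ gkDim K γ.diffOp := by
    intro μ h0 γ hγ
    obtain ⟨φ, hφ⟩ := PoissonStructure.exists_algHom_diffOp (Submonoid.powers μ) hγ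
    exact gkDim_le_of_injective φ (PoissonStructure.injective_of_forall_algebraMap (hinj h0) hφ)
  refine ⟨?_, ?_, fun i j μ hμ h0 => ?_⟩
  -- For any nonzero minor of size `d`, `t + d ≤ GK(PD(A)) ≤ GK(PD(A_μ)) ≤ t + d`.
  · obtain ⟨i, j, h0⟩ := exists_det_submatrix_ne_zero_of_fracRank _ hd.symm
    have := hdom h0
    have := het (μ := ((β.bracketMatrix (coordinate f A)).submatrix i j).det)
    obtain ⟨γ, hγ⟩ := PoissonStructure.exists_extends (B := Localization.Away
      ((β.bracketMatrix (coordinate f A)).submatrix i j).det) β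
    rw [hAd]
    exact le_antisymm ((hmono _ h0 γ hγ).trans (hle i j _ rfl h0 γ hγ).2) (hge i j h0)
  · rw [hAd]
    have h1 : (n : ℝ) - r + d = ((t + d : ℕ) : ℝ) := by
      rw [← hrt, ← hr]; push_cast; ring
    rw [h1]; rfl
  · have := hdom h0
    have := het (μ := μ)
    refine ⟨β.nonempty_oreSet_powers h0, β.nonempty_oreSet_powers_op h0, ?_, fun γ hγ => ⟨?_, ?_⟩⟩
    · obtain ⟨γ, hγ⟩ := PoissonStructure.exists_extends (B := Localization.Away μ) β
      exact ⟨γ, hγ, fun γ' hγ' => PoissonStructure.ext_of_extends hγ' hγ⟩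
    · intro _
      obtain ⟨hspan, hup⟩ := hle i j μ hμ h0 γ hγ
      obtain ⟨e, he⟩ := PoissonStructure.exists_oreLocalization_algEquiv (μ := μ) (hinj h0) hγ hspan
      refine ⟨⟨e, he⟩, ?_⟩
      rw [gkDim_congr e, hAd]
      exact le_antisymm hup ((hge i j (hμ ▸ h0)).trans (hmono μ h0 γ hγ))
    · have key : ∀ i j : Fin d → Fin n,
          ((β.bracketMatrix (coordinate f A)).submatrix i j).det ≠ 0 →
          IsUnit (algebraMap A (Localization.Away μ)
            ((β.bracketMatrix (coordinate f A)).submatrix i j).det) →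
          LinearIndependent (Localization.Away μ)
            (γ.padMonomial fun s => algebraMap A (Localization.Away μ) (coordinate f A (i s))) ∧
          (Submodule.span (Localization.Away μ) (Set.range
            (γ.padMonomial fun s => algebraMap A (Localization.Away μ) (coordinate f A (i s)))) :
              Set (Module.End K (Localization.Away μ))) = γ.diffOp := fun i j h1 hu =>
        ⟨γ.linearIndependent_padMonomial _ _
          (PoissonStructure.det_bracket_ne_zero_of_extends hγ (hinj h0) i j h1),
        γ.span_padMonomial_eq_diffOp
          (PoissonStructure.pad_mem_span_pad_of_extends hγ hgen hd.symm i j h1 hu)⟩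
      have hu := IsLocalization.Away.algebraMap_isUnit (S := Localization.Away μ) μ
      rintro k (rfl | rfl)
      · exact key k j (hμ ▸ h0) (hμ ▸ hu)
      · refine key k i ?_ ?_
        · rw [β.det_submatrix_bracketMatrix_swap, ← hμ]
          exact mul_ne_zero (pow_ne_zero _ (neg_ne_zero.2 one_ne_zero)) h0
        · rw [β.det_submatrix_bracketMatrix_swap, ← hμ, map_mul, map_pow, map_neg, map_one]
          exact (isUnit_one.neg.pow _).mul hu
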